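/- **Setting.** Let $n\ge 0$ and let $J=J^1(\mathbb R^n)\cong\mathbb R^{2n+1}$ have coordinates $z=(x^i,u,p_i)$ and contact form $\alpha=du-p_i\,dx^i$. For a smooth $H:J\to\mathbb R$ let $$X_H=\frac{\partial H}{\partial p_i}\frac{\partial}{\partial x^i}-\Big(\frac{\partial H}{\partial x^i}+p_i\frac{\partial H}{\partial u}\Big)\frac{\partial}{\partial p_i}+\Big(p_i\frac{\partial H}{\partial p_i}-H\Big)\frac{\partial}{\partial u}$$ be its contact Hamiltonian vector field and $\Phi_H^t$ the (maximal, possibly only partially defined) flow of $X_H$. The contact-Jacobi bracket is $$[H,K]=\sum_i\Big(\frac{\partial H}{\partial p_i}\frac{\partial K}{\partial x^i}-\frac{\partial H}{\partial x^i}\frac{\partial K}{\partial p_i}\Big)+\frac{\partial H}{\partial u}\Big(K-p_i\frac{\partial K}{\partial p_i}\Big)-\frac{\partial K}{\partial u}\Big(H-p_i\frac{\partial H}{\partial p_i}\Big).$$ A smooth function $H$ on $J$ is *strict* if $\partial H/\partial u=0$, and *prolonged* if $H(x,u,p)=f(x,u)+g^i(x,u)p_i$ with $f,g^i$ smooth.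 **Proposition.** Let $I$ be a finite set, let $s_0$ and $s_i$ ($i\in I$) be strict, let $d_0$ and $d_i$ ($i\in I$) be prolonged, and put $$H^{(N)}=s_0+d_0+\sum_{i\in I}[s_i,d_i].$$ Let $U\subset J$ be compact. Then for every $k\in\mathbb N$ there are finitely many generators $g_1,\dots,g_m\in\{s_0,d_0\}\cup\{s_i,d_i:i\in I\}$ and times $\tau_1(h),\dots,\tau_m(h)$, each of the form $\tau_j(h)=c_j|h|$ or $\tau_j(h)=c_j|h|^{1/2}$ with a real coefficient $c_j$ that depends on $h$ only through its sign, such that the composition of exact flows $$\Psi_{N,h}=\Phi_{g_m}^{\tau_m(h)}\circ\dots\circ\Phi_{g_1}^{\tau_1(h)}$$ has the following properties. 1. There are an open set $V\supset U$ and $h_0>0$ such that, for all $|h|<h_0$, the successive flows composing $\Psi_{N,h}$ and the flow $\Phi^h_{H^{(N)}}$ are defined at every point of $V$, $\Phi^h_{H^{(N)}}$ is smooth on $V$, and $\Psi_{N,h}$ is a contactomorphism from $V$ onto the open set $\Psi_{N,h}(V)$, i.e. a smooth diffeomorphism with $\Psi_{N,h}^*\alpha=e^{\lambda}\alpha$ for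 some function $\lambda$ on $V$. 2. For every finite $r$, $$\Psi_{N,h}=\Phi_{H^{(N)}}^h+O(h^{k+1})\quad\text{in }C^r(U)\text{ as }h\to0,$$ that is, there is a constant $C$ with $\max_{j\le r}\sup_{z\in U}\|D^j(\Psi_{N,h}-\Phi^h_{H^{(N)}})(z)\|\le C|h|^{k+1}$ for all sufficiently small $|h|$. -/

import Mathlib

open scoped ContDiff

namespace ContactSplitting

noncomputable section

/-- The jet space `J¹(ℝⁿ) ≅ ℝ²ⁿ⁺¹` in its global Darboux coordinates `z = (x, u, p)`. -/
abbrev Jet (n : ℕ) : Type := (Fin n → ℝ) × ℝ × (Fin n → ℝ)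

variable {n : ℕ}

/-- The partial derivative `∂H/∂xⁱ`. -/
def dx (H : Jet n → ℝ) (i : Fin n) (z : Jet n) : ℝ := fderiv ℝ H z (Pi.single i 1, 0, 0)

/-- The partial derivative `∂H/∂u`. -/
def du (H : Jet n → ℝ) (z : Jet n) : ℝ := fderiv ℝ H z (0, 1, 0)

/-- The partial derivative `∂H/∂pᵢ`. -/
def dp (H : Jet n → ℝ) (i : Fin n) (z : Jet n) : ℝ := fderiv ℝ H z (0, 0, Pi.single i 1)

/-- The contact form `α = du - pᵢ dxⁱ` at `z`, evaluated on the tangent vector `v`. -/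
def contactForm (z v : Jet n) : ℝ := v.2.1 - ∑ i, z.2.2 i * v.1 i

/-- The contact Hamiltonian vector field
`X_H = H_{pᵢ} ∂_{xⁱ} + (pᵢ H_{pᵢ} - H) ∂_u - (H_{xⁱ} + pᵢ H_u) ∂_{pᵢ}`. -/
def contactField (H : Jet n → ℝ) (z : Jet n) : Jet n :=
  (fun i => dp H i z,
    (∑ i, z.2.2 i * dp H i z) - H z,
    fun i => -(dx H i z + z.2.2 i * du H z))

/-- The Poisson bracket `{H, K} = H_{pᵢ} K_{xⁱ} - H_{xⁱ} K_{pᵢ}`. -/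
def poisson (H K : Jet n → ℝ) (z : Jet n) : ℝ :=
  ∑ i, (dp H i z * dx K i z - dx H i z * dp K i z)

/-- The Euler operator `E[H] = H - pᵢ H_{pᵢ}`. -/
def euler (H : Jet n → ℝ) (z : Jet n) : ℝ := H z - ∑ i, z.2.2 i * dp H i z

/-- The contact-Jacobi bracket `[H, K] = {H, K} + H_u E[K] - K_u E[H]`. -/
def jacobi (H K : Jet n → ℝ) (z : Jet n) : ℝ :=
  poisson H K z + du H z * euler K z - du K z * euler H z

/-- Strict contact Hamiltonians: smooth and independent of `u`. -/
def IsStrict (H : Jet n → ℝ) : Prop := ContDiff ℝ ∞ H ∧ ∀ z, du H z = 0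

/-- Prolonged Hamiltonians: smooth and affine in `p`, i.e. `H(x,u,p) = f(x,u) + gⁱ(x,u) pᵢ`. -/
def IsProlonged (H : Jet n → ℝ) : Prop :=
  ContDiff ℝ ∞ H ∧
    ∃ (f : (Fin n → ℝ) × ℝ → ℝ) (g : Fin n → (Fin n → ℝ) × ℝ → ℝ),
      ContDiff ℝ ∞ f ∧ (∀ i, ContDiff ℝ ∞ (g i)) ∧
        ∀ x u p, H (x, u, p) = f (x, u) + ∑ i, g i (x, u) * p i

/-- `γ` solves `γ' = X(γ)`, `γ(0) = z` on the closed interval between `0` and `t`. -/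
def Solves (X : Jet n → Jet n) (z : Jet n) (t : ℝ) (γ : ℝ → Jet n) : Prop :=
  γ 0 = z ∧ IsIntegralCurveOn γ (fun _ => X) (Set.uIcc 0 t)

/-- The exact flow of `X` through `z` exists up to the (positive or negative) time `t`. -/
def FlowDefined (X : Jet n → Jet n) (t : ℝ) (z : Jet n) : Prop := ∃ γ, Solves X z t γ

open Classical in
/-- The exact (maximal) flow of `X`: the value at time `t` of the solution starting at `z`.
For the smooth fields considered here the solution is unique. The value is meaningful
only where `FlowDefined X t z` holds. -/
def flow (X : Jet n → Jet n) (t : ℝ) (z : Jet n) : Jet n :=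
  if h : FlowDefined X t z then h.choose t else z

/-- The exact contact flow `Φ_H^t`. -/
def contactFlow (H : Jet n → ℝ) (t : ℝ) (z : Jet n) : Jet n := flow (contactField H) t z

/-- The point `z` lies in the domain of `Φ_H^t`. -/
def ContactFlowDefined (H : Jet n → ℝ) (t : ℝ) (z : Jet n) : Prop :=
  FlowDefined (contactField H) t z

/-- One factor `Φ_H^τ` of a splitting method. Its time `τ` is a fixed coefficient times
`|h|`, or times `√|h|` as in commutator gadgets; the coefficient is `cPos` for step sizes
`h ≥ 0` and `cNeg` for `h < 0`. -/
structure Factor (n : ℕ) where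
  ham : Jet n → ℝ
  sqrtScaled : Bool
  cPos : ℝ
  cNeg : ℝ

/-- The time for which the factor is run when the step size is `h`. -/
def Factor.time (F : Factor n) (h : ℝ) : ℝ :=
  (if 0 ≤ h then F.cPos else F.cNeg) * (if F.sqrtScaled then √|h| else |h|)

/-- The composition of the exact flows of the factors; the head of the list acts first. -/
def splittingMap : List (Factor n) → ℝ → Jet n → Jet n
  | [], _, z => z
  | F :: w, h, z => splittingMap w h (contactFlow F.ham (F.time h) z)

/-- Every exact flow in the composition exists at the point at which it is evaluated. -/
def SplittingDefined : List (Factor n) → ℝ → Jet n → Prop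
  | [], _, _ => True
  | F :: w, h, z =>
      ContactFlowDefined F.ham (F.time h) z ∧
        SplittingDefined w h (contactFlow F.ham (F.time h) z)

/-- `ψ` restricts to a contactomorphism from the open set `V` onto the open set `ψ(V)`:
a smooth diffeomorphism with `ψ^*α = e^ℓ α` on `V` for some function `ℓ`. -/
def IsContactomorphismOn (ψ : Jet n → Jet n) (V : Set (Jet n)) : Prop :=
  IsOpen V ∧ IsOpen (ψ '' V) ∧ ContDiffOn ℝ ∞ ψ V ∧
    (∃ χ : Jet n → Jet n, ContDiffOn ℝ ∞ χ (ψ '' V) ∧ Set.LeftInvOn χ ψ V) ∧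
      ∃ ℓ : Jet n → ℝ, ∀ z ∈ V, ∀ v : Jet n,
        contactForm (ψ z) (fderiv ℝ ψ z v) = Real.exp (ℓ z) * contactForm z v

/-- `‖f‖_{C^r(U)} ≤ B`: all derivatives of `f` of order at most `r` are bounded by `B` on `U`. -/
def CrNormLE (r : ℕ) (U : Set (Jet n)) (f : Jet n → Jet n) (B : ℝ) : Prop :=
  ∀ j ≤ r, ∀ z ∈ U, ‖iteratedFDeriv ℝ j f z‖ ≤ B

end

end ContactSplitting

/-!
A commutator of flows that are run for time `√h` is the flow of the bracket up to `O(h ^ (3 / 2))`,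
so in the parameter `τ = √h` a composition of flows of generators agrees with the flow of
`H = s₀ + d₀ + ∑ i, jacobi (s i) (d i)` modulo `τ ^ 3`. The words in flows can be inverted and their
times rescaled. If a word `f` agrees with the flow of `H` for time `τ ^ 2` modulo `τ ^ p`, with
leading error `τ ^ p • e`, the word `f(bτ)⁻¹ ∘ f(aτ) ∘ f(aτ)` has time `(2 a ^ 2 - b ^ 2) τ ^ 2` and
leading error `(2 a ^ p - b ^ p) τ ^ p • e`; as `p ≥ 3`, some `a` and `b` make the first coefficient
`1` and the second `0`, and the order of agreement can be raised indefinitely. For `h < 0` one runs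
the inverse word.

Agreement modulo `τ ^ p` means that the difference is `τ ^ p` times a family jointly smooth in `τ`
and the point; on compact sets this bounds all derivatives. Joint smoothness of flows is obtained
by applying the continuity of flows in the initial value to the field whose integral curves are
difference quotients of integral curves.
-/

namespace ContactSplitting

noncomputable section

open scoped Topology
open Set Metric Filter

section Hadamard

section Slope

variable {P E : Type*} [NormedAddCommGroup E] [NormedSpace ℝ E]

/-- The divided difference `(f(τ, p) - f(0, p)) / τ` of a one-parameter family `f`, completed at
`τ = 0` by the derivative. This is the quotient in Hadamard's lemma with parameters. -/
def paramSlope (f : ℝ × P → E) (y : ℝ × P) : E := dslope (fun τ => f (τ, y.2)) 0 y.1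

theorem eq_add_smul_paramSlope (f : ℝ × P → E) (y : ℝ × P) :
    f y = f (0, y.2) + y.1 • paramSlope f y := by
  have h := sub_smul_dslope (fun τ => f (τ, y.2)) 0 y.1
  rw [sub_zero] at h
  rw [paramSlope, h, add_sub_cancel]

theorem paramSlope_zero (f : ℝ × P → E) (p : P) :
    paramSlope f (0, p) = deriv (fun τ => f (τ, p)) 0 :=
  dslope_same _ _

theorem paramSlope_of_ne (f : ℝ × P → E) {y : ℝ × P} (hy : y.1 ≠ 0) :
    paramSlope f y = y.1⁻¹ • (f y - f (0, y.2)) := by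
  rw [eq_add_smul_paramSlope f y, add_sub_cancel_left, inv_smul_smul₀ hy]

theorem paramSlope_congr [TopologicalSpace P] {f g : ℝ × P → E} {p : P} (h : f =ᶠ[𝓝 (0, p)] g) :
    paramSlope f =ᶠ[𝓝 (0, p)] paramSlope g := by
  have hbase : ∀ᶠ y : ℝ × P in 𝓝 (0, p), ∀ᶠ τ in 𝓝 (0 : ℝ), f (τ, y.2) = g (τ, y.2) := by
    have hproj : Tendsto (fun y : ℝ × P => ((0 : ℝ), y.2)) (𝓝 (0, p)) (𝓝 (0, p)) :=
      (by fun_prop : Continuous fun y : ℝ × P => ((0 : ℝ), y.2)).tendsto _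
    exact (hproj.eventually h.eventually_nhds).mono fun y hy =>
      (by fun_prop : Continuous fun τ : ℝ => (τ, y.2)).continuousAt.eventually hy
  filter_upwards [h, hbase] with y hy hy₀
  rcases eq_or_ne y.1 0 with h₀ | h₀
  · rw [← y.eta, h₀, paramSlope_zero, paramSlope_zero, EventuallyEq.deriv_eq hy₀]
  · rw [paramSlope_of_ne f h₀, paramSlope_of_ne g h₀, hy, hy₀.self_of_nhds]

end Slope

variable {P E : Type*} [NormedAddCommGroup P] [NormedSpace ℝ P]
  [NormedAddCommGroup E] [NormedSpace ℝ E]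

theorem dslope_zero_eq_intervalIntegral [CompleteSpace E] {f : ℝ → E} (hf : ContDiff ℝ 1 f)
    (τ : ℝ) : dslope f 0 τ = ∫ s in (0 : ℝ)..1, deriv f (s * τ) := by
  rcases eq_or_ne τ 0 with rfl | hτ
  · simp
  · have hFTC := intervalIntegral.integral_deriv_eq_sub' (a := 0) (b := τ) f rfl
      (fun x _ => hf.differentiable (by simp) x) (hf.continuous_deriv (by simp)).continuousOn
    rw [dslope_of_ne _ hτ, slope_def_module, intervalIntegral.integral_comp_mul_right _ hτ]
    simp [hFTC]

theorem contDiff_fderiv_slice {m : WithTop ℕ∞} {h : P → ℝ → E}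
    (hh : ContDiff ℝ (m + 1) (Function.uncurry h)) :
    ContDiff ℝ m fun y : P × ℝ => fderiv ℝ (fun q => h q y.2) y.1 := by
  have huncurry : ContDiff ℝ (m + 1) (Function.uncurry fun (y : P × ℝ) (q : P) => h q y.2) :=
    hh.comp (f := fun y : (P × ℝ) × P => (y.2, y.1.2)) (by fun_prop)
  exact ContDiff.fderiv huncurry contDiff_fst le_rfl

theorem hasFDerivAt_intervalIntegral [FiniteDimensional ℝ P] {h : P → ℝ → E}
    (hh : ContDiff ℝ 1 (Function.uncurry h)) (a b : ℝ) (p : P) :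
    HasFDerivAt (fun q => ∫ s in a..b, h q s) (∫ s in a..b, fderiv ℝ (fun q => h q s) p) p := by
  have hdiff (s : ℝ) : Differentiable ℝ fun q => h q s :=
    (hh.comp (f := fun q : P => (q, s)) (by fun_prop)).differentiable (by simp)
  have hcont (q : P) : Continuous (h q) :=
    hh.continuous.comp (by fun_prop : Continuous fun s : ℝ => (q, s))
  have hderiv := (contDiff_fderiv_slice (m := 0) (by simpa using hh)).continuous
  obtain ⟨C, hC⟩ := ((isCompact_closedBall p 1).prod isCompact_uIcc).exists_bound_of_continuousOn
    (hderiv.continuousOn (s := closedBall p 1 ×ˢ uIcc a b))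
  exact intervalIntegral.hasFDerivAt_integral_of_dominated_of_fderiv_le (bound := fun _ => C)
    (closedBall_mem_nhds p one_pos) (.of_forall fun q => (hcont q).aestronglyMeasurable)
    ((hcont p).intervalIntegrable _ _)
    (hderiv.comp (by fun_prop : Continuous fun s : ℝ => (p, s))).aestronglyMeasurable
    (.of_forall fun s hs q hq => hC (q, s) ⟨hq, uIoc_subset_uIcc hs⟩) intervalIntegrable_const
    (.of_forall fun s _ q _ => (hdiff s q).hasFDerivAt)

theorem contDiff_intervalIntegral [FiniteDimensional ℝ P] (m : ℕ) {h : P → ℝ → E}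
    (hh : ContDiff ℝ m (Function.uncurry h)) (a b : ℝ) :
    ContDiff ℝ m fun p => ∫ s in a..b, h p s := by
  induction m generalizing h with
  | zero =>
    exact contDiff_zero.2
      (intervalIntegral.continuous_parametric_intervalIntegral_of_continuous' hh.continuous a b)
  | succ m ih =>
    push_cast at hh ⊢
    have hderiv := hasFDerivAt_intervalIntegral (hh.of_le le_add_self) a b
    have hslice := contDiff_fderiv_slice hh
    refine contDiff_succ_iff_fderiv_apply.2
      ⟨fun p => (hderiv p).differentiableAt, by simp, fun v => ?_⟩
    have hcont (p : P) : Continuous fun s => fderiv ℝ (fun q => h q s) p :=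
      hslice.continuous.comp (by fun_prop : Continuous fun s : ℝ => (p, s))
    have happly (p : P) : fderiv ℝ (fun q => ∫ s in a..b, h q s) p v =
        ∫ s in a..b, fderiv ℝ (fun q => h q s) p v := by
      rw [(hderiv p).fderiv,
        ContinuousLinearMap.intervalIntegral_apply ((hcont p).intervalIntegrable a b)]
    simp only [happly]
    exact ih (hslice.clm_apply contDiff_const)

theorem exists_contDiff_eventuallyEq [FiniteDimensional ℝ P] {m : ℕ} {f : P → E} {x : P}
    (hf : ContDiffAt ℝ m f x) : ∃ g, ContDiff ℝ m g ∧ g =ᶠ[𝓝 x] f := by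
  obtain ⟨ε, hε, hball⟩ := Metric.eventually_nhds_iff_ball.1 (hf.eventually (by simp))
  let χ : ContDiffBump x := ⟨ε / 3, ε / 2, by positivity, by linarith⟩
  refine ⟨fun y => χ y • f y, contDiff_iff_contDiffAt.2 fun y => ?_, ?_⟩
  · by_cases hy : y ∈ tsupport χ
    · rw [χ.tsupport_eq] at hy
      exact χ.contDiff.contDiffAt.smul (hball y (closedBall_subset_ball (half_lt_self hε) hy))
    · refine (contDiffAt_const (c := (0 : E))).congr_of_eventuallyEq ?_
      filter_upwards [notMem_tsupport_iff_eventuallyEq.1 hy] with q hq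
      simp [hq]
  · filter_upwards [χ.eventuallyEq_one] with y hy
    simp [hy]

variable [FiniteDimensional ℝ P] [CompleteSpace E]

theorem contDiff_paramSlope (m : ℕ) {f : ℝ × P → E} (hf : ContDiff ℝ (m + 1) f) :
    ContDiff ℝ m (paramSlope f) := by
  have hslice (p : P) : ContDiff ℝ 1 fun τ : ℝ => f (τ, p) :=
    (hf.of_le le_add_self).comp (f := fun τ : ℝ => (τ, p)) (by fun_prop)
  have hderiv (p : P) (τ : ℝ) : deriv (fun τ => f (τ, p)) τ = fderiv ℝ f (τ, p) (1, 0) :=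
    ((hf.differentiable (by simp) (τ, p)).hasFDerivAt.comp_hasDerivAt τ
      ((hasDerivAt_id τ).prodMk (hasDerivAt_const τ p))).deriv
  have hint : paramSlope f =
      fun y => ∫ s in (0 : ℝ)..1, fderiv ℝ f (s * y.1, y.2) (1, 0) := by
    funext y
    rw [paramSlope, dslope_zero_eq_intervalIntegral (hslice y.2)]
    simp only [hderiv]
  rw [hint]
  exact contDiff_intervalIntegral m (((hf.fderiv_right le_rfl).comp
    (f := fun q : (ℝ × P) × ℝ => (q.2 * q.1.1, q.1.2)) (by fun_prop)).clm_apply contDiff_const) 0 1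

theorem contDiff_infty_paramSlope {f : ℝ × P → E} (hf : ContDiff ℝ ∞ f) :
    ContDiff ℝ ∞ (paramSlope f) :=
  contDiff_infty.2 fun m => contDiff_paramSlope m (contDiff_infty.1 hf (m + 1))

theorem contDiffAt_infty_paramSlope {f : ℝ × P → E} {p : P} (hf : ContDiffAt ℝ ∞ f (0, p)) :
    ContDiffAt ℝ ∞ (paramSlope f) (0, p) := by
  refine contDiffAt_infty.2 fun m => ?_
  obtain ⟨g, hg, hgf⟩ := exists_contDiff_eventuallyEq (contDiffAt_infty.1 hf (m + 1))
  exact (contDiff_paramSlope m hg).contDiffAt.congr_of_eventuallyEq (paramSlope_congr hgf.symm)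

end Hadamard

section TimeOneMap

variable {E : Type*} [NormedAddCommGroup E] [NormedSpace ℝ E]

/-- `γ` is an integral curve of `X` over the unit interval that starts at `z`. Flows are studied
through their time-one maps: the flow of `X` at time `t` is the time-one map of `t • X`. -/
def IsUnitCurve (X : E → E) (z : E) (γ : ℝ → E) : Prop :=
  γ 0 = z ∧ IsIntegralCurveOn γ (fun _ => X) (Icc 0 1)

/-- The point `z` lies in the domain of the time-one map of `X`. -/
def UnitFlowDefined (X : E → E) (z : E) : Prop := ∃ γ, IsUnitCurve X z γ

open Classical in
/-- The time-one map of the vector field `X`, extended by the identity outside its domain. -/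
def timeOneMap (X : E → E) (z : E) : E := if h : UnitFlowDefined X z then h.choose 1 else z

theorem isUnitCurve_const {X : E → E} {z : E} (hz : X z = 0) : IsUnitCurve X z fun _ => z :=
  ⟨rfl, (isIntegralCurve_const fun _ => hz).isIntegralCurveOn _⟩

theorem isIntegralCurveOn_comp_affine {X : E → E} {γ : ℝ → E} {s s' : Set ℝ}
    (hγ : IsIntegralCurveOn γ (fun _ => X) s) (a c : ℝ) (hs : MapsTo (fun t => a + t * c) s' s) :
    IsIntegralCurveOn (fun t => γ (a + t * c)) (fun _ => c • X) s' := fun t ht =>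
  (hγ _ (hs ht)).scomp t ((hasDerivAt_mul_const c).const_add a).hasDerivWithinAt hs

theorem IsUnitCurve.hasDerivWithinAt_Ici {X : E → E} {z : E} {γ : ℝ → E}
    (hγ : IsUnitCurve X z γ) :
    ∀ t ∈ Ico (0 : ℝ) 1, HasDerivWithinAt γ (X (γ t)) (Ici t) t := fun t ht =>
  (hγ.2 t (Ico_subset_Icc_self ht)).mono_of_mem_nhdsWithin (Icc_mem_nhdsGE_of_mem ht)

theorem IsUnitCurve.continuousOn {X : E → E} {z : E} {γ : ℝ → E} (hγ : IsUnitCurve X z γ) :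
    ContinuousOn γ (Icc 0 1) := IsIntegralCurveOn.continuousOn hγ.2

theorem IsUnitCurve.exists_norm_lt {X : E → E} {z : E} {γ : ℝ → E} (hγ : IsUnitCurve X z γ) :
    ∃ R > 0, ∀ t ∈ Icc (0 : ℝ) 1, ‖γ t‖ < R := by
  obtain ⟨C, hC⟩ := isCompact_Icc.exists_bound_of_continuousOn hγ.continuousOn
  exact ⟨|C| + 1, by positivity, fun t ht =>
    (hC t ht).trans_lt ((le_abs_self C).trans_lt (lt_add_one _))⟩

theorem IsUnitCurve.congr {X Y : E → E} {z : E} {γ : ℝ → E} (hγ : IsUnitCurve X z γ)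
    (hXY : ∀ t ∈ Icc (0 : ℝ) 1, Y (γ t) = X (γ t)) : IsUnitCurve Y z γ :=
  ⟨hγ.1, fun t ht => (hγ.2 t ht).congr_deriv (hXY t ht).symm⟩

theorem IsUnitCurve.reverse {X : E → E} {z : E} {γ : ℝ → E} (hγ : IsUnitCurve X z γ) :
    IsUnitCurve (-X) (γ 1) fun t => γ (1 - t) := by
  refine ⟨by simp, ?_⟩
  have hmaps : MapsTo (fun t : ℝ => 1 + t * -1) (Icc 0 1) (Icc 0 1) := fun t ht =>
    ⟨by linarith [ht.2], by linarith [ht.1]⟩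
  simpa [sub_eq_add_neg] using isIntegralCurveOn_comp_affine hγ.2 1 (-1) hmaps

theorem IsUnitCurve.dist_le {X : E → E} {K : NNReal} (hX : LipschitzWith K X) {z z' : E}
    {γ γ' : ℝ → E} (hγ : IsUnitCurve X z γ) (hγ' : IsUnitCurve X z' γ') {t : ℝ}
    (ht : t ∈ Icc (0 : ℝ) 1) : dist (γ t) (γ' t) ≤ dist z z' * Real.exp K := by
  refine (dist_le_of_trajectories_ODE (v := fun _ => X) (fun _ => hX) hγ.continuousOn
    hγ.hasDerivWithinAt_Ici hγ'.continuousOn hγ'.hasDerivWithinAt_Ici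
    (by rw [hγ.1, hγ'.1]) t ht).trans ?_
  have htime : (K : ℝ) * (t - 0) ≤ K := by
    simpa using mul_le_mul_of_nonneg_left ht.2 K.2
  gcongr

variable [FiniteDimensional ℝ E]

theorem exists_bounded_lipschitz_eqOn {X : E → E} (hX : ContDiff ℝ 1 X) {R : ℝ} (hR : 0 < R) :
    ∃ (Y : E → E) (K M : NNReal), LipschitzWith K Y ∧ (∀ x, ‖Y x‖ ≤ M) ∧
      EqOn Y X (closedBall 0 R) := by
  let χ : ContDiffBump (0 : E) := ⟨R, R + 1, hR, by linarith⟩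
  have hsupport : HasCompactSupport fun x => χ x • X x := χ.hasCompactSupport.smul_right
  have hsmooth : ContDiff ℝ 1 fun x => χ x • X x := χ.contDiff.smul hX
  obtain ⟨K, hK⟩ := hsmooth.lipschitzWith_of_hasCompactSupport hsupport one_ne_zero
  obtain ⟨M, hM⟩ := hsupport.exists_bound_of_continuous hsmooth.continuous
  refine ⟨_, K, M.toNNReal, hK, fun x => (hM x).trans (Real.le_coe_toNNReal M), fun x hx => ?_⟩
  simp only [χ.one_of_mem_closedBall hx, one_smul]

theorem IsUnitCurve.eqOn {X : E → E} (hX : ContDiff ℝ 1 X) {z : E} {γ γ' : ℝ → E}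
    (hγ : IsUnitCurve X z γ) (hγ' : IsUnitCurve X z γ') : EqOn γ γ' (Icc 0 1) := by
  obtain ⟨R, hR, hbound⟩ := hγ.exists_norm_lt
  obtain ⟨R', -, hbound'⟩ := hγ'.exists_norm_lt
  obtain ⟨Y, K, -, hK, -, hY⟩ := exists_bounded_lipschitz_eqOn hX (lt_max_of_lt_left (c := R') hR)
  have hγY : IsUnitCurve Y z γ := hγ.congr fun t ht =>
    hY (by simpa using .inl (hbound t ht).le)
  have hγY' : IsUnitCurve Y z γ' := hγ'.congr fun t ht =>
    hY (by simpa using .inr (hbound' t ht).le)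
  exact fun t ht => dist_le_zero.1 (by simpa using hγY.dist_le hK hγY' ht)

theorem IsUnitCurve.timeOneMap_eq {X : E → E} (hX : ContDiff ℝ 1 X) {z : E} {γ : ℝ → E}
    (hγ : IsUnitCurve X z γ) : timeOneMap X z = γ 1 := by
  have h : UnitFlowDefined X z := ⟨γ, hγ⟩
  rw [timeOneMap, dif_pos h]
  exact h.choose_spec.eqOn hX hγ (right_mem_Icc.2 zero_le_one)

theorem unitFlowDefined_of_lipschitz {X : E → E} {K M : NNReal} (hK : LipschitzWith K X)
    (hM : ∀ x, ‖X x‖ ≤ M) (z : E) : UnitFlowDefined X z := by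
  have hPL : IsPicardLindelof (fun _ : ℝ => X) (tmin := 0) (tmax := 1)
      ⟨0, left_mem_Icc.2 zero_le_one⟩ z M 0 M K :=
    ⟨fun _ _ => hK.lipschitzOnWith, fun _ _ => continuousOn_const, fun _ _ y _ => hM y, by simp⟩
  exact hPL.exists_eq_forall_mem_Icc_hasDerivWithinAt₀

theorem exists_eventually_unitFlowDefined {X : E → E} (hX : ContDiff ℝ 1 X) {z : E}
    (hz : UnitFlowDefined X z) : ∃ C : ℝ, ∀ᶠ x in 𝓝 z,
      UnitFlowDefined X x ∧ dist (timeOneMap X x) (timeOneMap X z) ≤ dist x z * C := by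
  obtain ⟨γ, hγ⟩ := hz
  obtain ⟨R, hR, hbound⟩ := hγ.exists_norm_lt
  obtain ⟨Y, K, M, hK, hM, hY⟩ := exists_bounded_lipschitz_eqOn hX (add_pos hR one_pos)
  have hγY : IsUnitCurve Y z γ := hγ.congr fun t ht =>
    hY (by simpa using (hbound t ht).le.trans (le_add_of_nonneg_right zero_le_one))
  refine ⟨Real.exp K, ?_⟩
  filter_upwards [ball_mem_nhds z (Real.exp_pos (-(K : ℝ)))] with x hx
  obtain ⟨η, hη⟩ := unitFlowDefined_of_lipschitz hK hM x
  have hlt : dist x z * Real.exp K < 1 := by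
    have h := mul_lt_mul_of_pos_right (mem_ball.1 hx) (Real.exp_pos (K : ℝ))
    rwa [← Real.exp_add, neg_add_cancel, Real.exp_zero] at h
  have hηX : IsUnitCurve X x η := hη.congr fun t ht => by
    refine (hY (mem_closedBall_zero_iff.2 ?_)).symm
    have h := norm_le_norm_add_norm_sub' (η t) (γ t)
    rw [← dist_eq_norm] at h
    linarith [hη.dist_le hK hγY ht, hbound t ht]
  refine ⟨⟨η, hηX⟩, ?_⟩
  rw [hηX.timeOneMap_eq hX, hγ.timeOneMap_eq hX]
  exact hη.dist_le hK hγY (right_mem_Icc.2 zero_le_one)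

theorem isOpen_setOf_unitFlowDefined {X : E → E} (hX : ContDiff ℝ 1 X) :
    IsOpen {z | UnitFlowDefined X z} :=
  isOpen_iff_mem_nhds.2 fun _ hz =>
    let ⟨_, hC⟩ := exists_eventually_unitFlowDefined hX hz
    hC.mono fun _ h => h.1

theorem continuousAt_timeOneMap {X : E → E} (hX : ContDiff ℝ 1 X) {z : E}
    (hz : UnitFlowDefined X z) : ContinuousAt (timeOneMap X) z := by
  obtain ⟨C, hC⟩ := exists_eventually_unitFlowDefined hX hz
  refine tendsto_iff_dist_tendsto_zero.2 (squeeze_zero' (.of_forall fun _ => dist_nonneg)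
    (hC.mono fun _ h => h.2) ?_)
  simpa using (by fun_prop : Continuous fun x => dist x z * C).tendsto z

theorem timeOneMap_neg {X : E → E} (hX : ContDiff ℝ 1 X) {z : E} (hz : UnitFlowDefined X z) :
    UnitFlowDefined (-X) (timeOneMap X z) ∧ timeOneMap (-X) (timeOneMap X z) = z := by
  obtain ⟨γ, hγ⟩ := hz
  rw [hγ.timeOneMap_eq hX]
  exact ⟨⟨_, hγ.reverse⟩, by rw [hγ.reverse.timeOneMap_eq (X := -X) hX.neg, sub_self, hγ.1]⟩

end TimeOneMap

section Variation

variable {E : Type*} [NormedAddCommGroup E] [NormedSpace ℝ E]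

/-- The field on triples `(x, v, ε)` whose integral curves with `ε ≠ 0` record an integral curve
of `X` from `x` and its difference quotient with the one from `x + ε v`; at `ε = 0` the second
component becomes the variational equation. Its smoothness therefore yields, at one stroke, the
differentiability of the time-one map and the smoothness of its derivative. -/
def differenceField (X : E → E) (q : E × E × ℝ) : E × E × ℝ :=
  (X q.1, paramSlope (fun y : ℝ × E × E => X (y.2.1 + y.1 • y.2.2)) (q.2.2, q.1, q.2.1), 0)

/-- `η` solves the variational equation along the integral curve `γ` of `X`. -/
def IsVariation (X : E → E) (γ : ℝ → E) (v : E) (η : ℝ → E) : Prop :=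
  η 0 = v ∧ ∀ t ∈ Icc (0 : ℝ) 1, HasDerivWithinAt η (fderiv ℝ X (γ t) (η t)) (Icc 0 1) t

theorem IsVariation.add {X : E → E} {γ η η' : ℝ → E} {v v' : E} (h : IsVariation X γ v η)
    (h' : IsVariation X γ v' η') : IsVariation X γ (v + v') fun t => η t + η' t :=
  ⟨by simp only [h.1, h'.1], fun t ht => by simpa using (h.2 t ht).fun_add (h'.2 t ht)⟩

theorem IsVariation.smul {X : E → E} {γ η : ℝ → E} {v : E} (h : IsVariation X γ v η) (c : ℝ) :
    IsVariation X γ (c • v) fun t => c • η t :=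
  ⟨by simp only [h.1], fun t ht => by simpa using (h.2 t ht).fun_const_smul c⟩

theorem isVariation_zero (X : E → E) (γ : ℝ → E) : IsVariation X γ 0 fun _ => 0 :=
  ⟨rfl, fun t _ => by simpa using hasDerivWithinAt_const t _ _⟩

theorem differenceField_zero {X : E → E} (hX : Differentiable ℝ X) (x v : E) :
    differenceField X (x, v, 0) = (X x, fderiv ℝ X x v, 0) := by
  have hline : HasDerivAt (fun e : ℝ => x + e • v) v 0 := by
    simpa using ((hasDerivAt_id (0 : ℝ)).smul_const v).const_add x
  have hXx : HasFDerivAt X (fderiv ℝ X x) (x + (0 : ℝ) • v) := by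
    simpa using (hX x).hasFDerivAt
  rw [differenceField, paramSlope_zero]
  exact congrArg (fun w => (X x, w, (0 : ℝ))) (hXx.comp_hasDerivAt 0 hline).deriv

theorem isUnitCurve_differenceField_zero {X : E → E} (hX : Differentiable ℝ X) {x v : E}
    {γ η : ℝ → E} (hγ : IsUnitCurve X x γ) (hη : IsVariation X γ v η) :
    IsUnitCurve (differenceField X) (x, v, 0) fun t => (γ t, η t, 0) := by
  refine ⟨by simp only [hγ.1, hη.1], fun t ht => ?_⟩
  simp only [differenceField_zero hX]
  exact (hγ.2 t ht).prodMk ((hη.2 t ht).prodMk (hasDerivWithinAt_const t _ _))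

theorem isUnitCurve_differenceField {X : E → E} {x v : E} {γ γ' : ℝ → E} {ε : ℝ} (hε : ε ≠ 0)
    (hγ : IsUnitCurve X x γ) (hγ' : IsUnitCurve X (x + ε • v) γ') :
    IsUnitCurve (differenceField X) (x, v, ε) fun t => (γ t, ε⁻¹ • (γ' t - γ t), ε) := by
  refine ⟨by simp [hγ.1, hγ'.1, inv_smul_smul₀ hε], fun t ht => ?_⟩
  have hquot := ((hγ'.2 t ht).fun_sub (hγ.2 t ht)).fun_const_smul ε⁻¹
  refine (hγ.2 t ht).prodMk (HasDerivWithinAt.prodMk ?_ (hasDerivWithinAt_const t _ _))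
  simpa [paramSlope_of_ne _ (y := (ε, γ t, ε⁻¹ • (γ' t - γ t))) hε, smul_inv_smul₀ hε] using hquot

variable [FiniteDimensional ℝ E] {X : E → E}

theorem contDiff_differenceField (hX : ContDiff ℝ ∞ X) : ContDiff ℝ ∞ (differenceField X) := by
  have hslope := contDiff_infty_paramSlope
    (f := fun y : ℝ × E × E => X (y.2.1 + y.1 • y.2.2)) (hX.comp (by fun_prop))
  exact (hX.comp contDiff_fst).prodMk ((hslope.comp
    (f := fun q : E × E × ℝ => (q.2.2, q.1, q.2.1)) (by fun_prop)).prodMk contDiff_const)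

theorem IsUnitCurve.exists_isVariation_of_unitFlowDefined (hX : ContDiff ℝ 1 X) {x v : E}
    {γ : ℝ → E} (hγ : IsUnitCurve X x γ) (h : UnitFlowDefined (differenceField X) (x, v, 0)) :
    ∃ η, IsVariation X γ v η := by
  obtain ⟨q, hq₀, hq⟩ := h
  have hfst : IsUnitCurve X x fun t => (q t).1 := ⟨by simp only [hq₀], fun t ht => (hq t ht).fst⟩
  have hparam : IsUnitCurve (0 : ℝ → ℝ) 0 fun t => (q t).2.2 :=
    ⟨by simp only [hq₀], fun t ht => (hq t ht).snd.snd⟩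
  refine ⟨fun t => (q t).2.1, by simp only [hq₀], fun t ht => ?_⟩
  have hqt : q t = (γ t, (q t).2.1, 0) := Prod.ext (hfst.eqOn hX hγ ht)
    (Prod.ext rfl (hparam.eqOn contDiff_const (isUnitCurve_const rfl) ht))
  have hderiv := (hq t ht).snd.fst
  simp only at hderiv
  rwa [hqt, differenceField_zero (hX.differentiable one_ne_zero)] at hderiv

theorem IsUnitCurve.exists_isVariation (hX : ContDiff ℝ ∞ X) {x : E} {γ : ℝ → E}
    (hγ : IsUnitCurve X x γ) (v : E) : ∃ η, IsVariation X γ v η := by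
  have hX₁ : ContDiff ℝ 1 X := hX.of_le (by simp)
  have hzero : UnitFlowDefined (differenceField X) (x, (0 : ℝ) • v, 0) := by
    rw [zero_smul]
    exact ⟨_, isUnitCurve_differenceField_zero (hX₁.differentiable one_ne_zero) hγ
      (isVariation_zero X γ)⟩
  have hopen := isOpen_setOf_unitFlowDefined
    ((contDiff_differenceField hX).of_le (m := 1) (by simp))
  -- By linearity it suffices to solve the equation for a small multiple of `v`.
  have hsmall : ∀ᶠ c : ℝ in 𝓝 0, UnitFlowDefined (differenceField X) (x, c • v, 0) :=
    (by fun_prop : Continuous fun c : ℝ => (x, c • v, (0 : ℝ))).continuousAt.eventually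
      (hopen.mem_nhds hzero)
  obtain ⟨c, hc, hc₀⟩ := ((hsmall.filter_mono nhdsWithin_le_nhds).and
    (self_mem_nhdsWithin (s := {0}ᶜ))).exists
  obtain ⟨η, hη⟩ := hγ.exists_isVariation_of_unitFlowDefined hX₁ hc
  exact ⟨_, by simpa [inv_smul_smul₀ hc₀] using hη.smul c⁻¹⟩

theorem IsVariation.timeOneMap_eq (hX : ContDiff ℝ ∞ X) {x v : E} {γ η : ℝ → E}
    (hγ : IsUnitCurve X x γ) (hη : IsVariation X γ v η) :
    (timeOneMap (differenceField X) (x, v, 0)).2.1 = η 1 := by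
  rw [(isUnitCurve_differenceField_zero (hX.differentiable (by simp)) hγ hη).timeOneMap_eq
    ((contDiff_differenceField hX).of_le (by simp))]

theorem unitFlowDefined_differenceField (hX : ContDiff ℝ ∞ X) {x : E} (hx : UnitFlowDefined X x)
    (v : E) : UnitFlowDefined (differenceField X) (x, v, 0) := by
  obtain ⟨γ, hγ⟩ := hx
  obtain ⟨η, hη⟩ := hγ.exists_isVariation hX v
  exact ⟨_, isUnitCurve_differenceField_zero (hX.differentiable (by simp)) hγ hη⟩

theorem timeOneMap_add_smul (hX : ContDiff ℝ ∞ X) {x v : E} {ε : ℝ} (hx : UnitFlowDefined X x)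
    (hv : UnitFlowDefined X (x + ε • v)) :
    timeOneMap X (x + ε • v) =
      timeOneMap X x + ε • (timeOneMap (differenceField X) (x, v, ε)).2.1 := by
  rcases eq_or_ne ε 0 with rfl | hε
  · simp
  obtain ⟨γ, hγ⟩ := hx
  obtain ⟨γ', hγ'⟩ := hv
  have hX₁ : ContDiff ℝ 1 X := hX.of_le (by simp)
  rw [(isUnitCurve_differenceField hε hγ hγ').timeOneMap_eq
    ((contDiff_differenceField hX).of_le (by simp)), hγ.timeOneMap_eq hX₁, hγ'.timeOneMap_eq hX₁,
    smul_inv_smul₀ hε, add_sub_cancel]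

theorem exists_continuousLinearMap_timeOneMap_differenceField (hX : ContDiff ℝ ∞ X) {x : E}
    (hx : UnitFlowDefined X x) :
    ∃ L : E →L[ℝ] E, ∀ v, L v = (timeOneMap (differenceField X) (x, v, 0)).2.1 := by
  obtain ⟨γ, hγ⟩ := hx
  choose η hη using hγ.exists_isVariation hX
  have heval {v η'} (h : IsVariation X γ v η') :
      (timeOneMap (differenceField X) (x, v, 0)).2.1 = η' 1 := h.timeOneMap_eq hX hγ
  have hlin : IsLinearMap ℝ fun v => (timeOneMap (differenceField X) (x, v, 0)).2.1 :=
    ⟨fun v w => by rw [heval ((hη v).add (hη w)), heval (hη v), heval (hη w)],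
      fun c v => by rw [heval ((hη v).smul c), heval (hη v)]⟩
  exact ⟨LinearMap.toContinuousLinearMap hlin.mk', fun v => rfl⟩

theorem hasFDerivAt_of_continuousAt_quotient {F : Type*} [NormedAddCommGroup F] [NormedSpace ℝ F]
    {f : E → F} {x : E} {L : E →L[ℝ] F} {q : ℝ × E → F} (hq : ∀ v, ContinuousAt q (0, v))
    (hqL : ∀ v, q (0, v) = L v)
    (hf : ∀ᶠ h in 𝓝 (0 : E), ∀ (ε : ℝ) (v : E), ε • v = h → f (x + h) = f x + ε • q (ε, v)) :
    HasFDerivAt f L x := by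
  rw [hasFDerivAt_iff_isLittleO_nhds_zero, Asymptotics.isLittleO_iff]
  intro c hc
  have hnear : ∀ v ∈ closedBall (0 : E) 1,
      ∀ᶠ y : ℝ × E in 𝓝 0 ×ˢ 𝓝 v, ‖q y - L y.2‖ < c := fun v _ => by
    have hcont : ContinuousAt (fun y : ℝ × E => ‖q y - L y.2‖) (0, v) :=
      ((hq v).sub (by fun_prop)).norm
    rw [← nhds_prod_eq]
    exact hcont.eventually_lt_const (by simpa [hqL] using hc)
  have hunif := (isCompact_closedBall (0 : E) 1).eventually_forall_of_forall_eventually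
    (x₀ := (0 : ℝ)) (P := fun ε v => ‖q (ε, v) - L v‖ < c) (fun v hv => by
      simpa only [nhds_prod_eq] using hnear v hv)
  have hnorm : Tendsto (fun h : E => ‖h‖) (𝓝 0) (𝓝 0) := by
    simpa using (continuous_norm (E := E)).tendsto 0
  filter_upwards [hf, hnorm.eventually hunif] with h hh hbound
  have hdir : ‖h‖ • (‖h‖⁻¹ • h) = h := by
    rcases eq_or_ne h 0 with rfl | h₀
    · simp
    · exact smul_inv_smul₀ (norm_ne_zero_iff.2 h₀) h
  have hmem : ‖h‖⁻¹ • h ∈ closedBall (0 : E) 1 := by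
    simpa [norm_smul] using inv_mul_le_one
  have hL : L h = ‖h‖ • L (‖h‖⁻¹ • h) := by rw [← map_smul, hdir]
  rw [hh _ _ hdir, add_sub_cancel_left, hL, ← smul_sub, norm_smul, norm_norm, mul_comm]
  exact mul_le_mul_of_nonneg_right (hbound _ hmem).le (norm_nonneg h)

theorem hasFDerivAt_timeOneMap (hX : ContDiff ℝ ∞ X) {x : E} (hx : UnitFlowDefined X x)
    {L : E →L[ℝ] E} (hL : ∀ v, L v = (timeOneMap (differenceField X) (x, v, 0)).2.1) :
    HasFDerivAt (timeOneMap X) L x := by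
  have hX₁ : ContDiff ℝ 1 (differenceField X) := (contDiff_differenceField hX).of_le (by simp)
  refine hasFDerivAt_of_continuousAt_quotient
    (q := fun y => (timeOneMap (differenceField X) (x, y.2, y.1)).2.1) (fun v => ?_)
    (fun v => (hL v).symm) ?_
  · have h := ContinuousAt.comp (f := fun y : ℝ × E => (x, y.2, y.1)) (x := (0, v))
      (continuousAt_timeOneMap hX₁ (unitFlowDefined_differenceField hX hx v)) (by fun_prop)
    exact h.snd.fst
  · have hdef : ∀ᶠ h in 𝓝 (0 : E), UnitFlowDefined X (x + h) :=
      (by fun_prop : ContinuousAt (fun h : E => x + h) 0).eventually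
        ((isOpen_setOf_unitFlowDefined (hX.of_le (by simp))).mem_nhds (by simpa using hx))
    filter_upwards [hdef] with h hh ε v hεv
    rw [← hεv] at hh ⊢
    exact timeOneMap_add_smul hX hx hh

theorem fderiv_timeOneMap (hX : ContDiff ℝ ∞ X) {x : E} (hx : UnitFlowDefined X x) (v : E) :
    fderiv ℝ (timeOneMap X) x v = (timeOneMap (differenceField X) (x, v, 0)).2.1 := by
  obtain ⟨L, hL⟩ := exists_continuousLinearMap_timeOneMap_differenceField hX hx
  rw [(hasFDerivAt_timeOneMap hX hx hL).fderiv, hL]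

theorem IsVariation.fderiv_timeOneMap_eq (hX : ContDiff ℝ ∞ X) {x v : E} {γ η : ℝ → E}
    (hγ : IsUnitCurve X x γ) (hη : IsVariation X γ v η) :
    fderiv ℝ (timeOneMap X) x v = η 1 := by
  rw [fderiv_timeOneMap hX ⟨γ, hγ⟩, hη.timeOneMap_eq hX hγ]

theorem contDiffOn_nat_timeOneMap (m : ℕ) {X : E → E} (hX : ContDiff ℝ ∞ X) :
    ContDiffOn ℝ m (timeOneMap X) {z | UnitFlowDefined X z} := by
  induction m generalizing E with
  | zero =>
    exact contDiffOn_zero.2 fun z hz =>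
      (continuousAt_timeOneMap (hX.of_le (by simp)) hz).continuousWithinAt
  | succ m ih =>
    push_cast
    refine (contDiffOn_succ_iff_fderiv_of_isOpen
      (isOpen_setOf_unitFlowDefined (hX.of_le (by simp)))).2
      ⟨fun z hz => ?_, by simp, contDiffOn_clm_apply.2 fun v => ?_⟩
    · obtain ⟨L, hL⟩ := exists_continuousLinearMap_timeOneMap_differenceField hX hz
      exact (hasFDerivAt_timeOneMap hX hz hL).differentiableAt.differentiableWithinAt
    · have hcomp := (ih (contDiff_differenceField hX)).comp
        (f := fun x : E => (x, v, (0 : ℝ))) (by fun_prop)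
        fun x hx => unitFlowDefined_differenceField hX hx v
      exact hcomp.snd.fst.congr fun x hx => fderiv_timeOneMap hX hx v

theorem contDiffOn_timeOneMap (hX : ContDiff ℝ ∞ X) :
    ContDiffOn ℝ ∞ (timeOneMap X) {z | UnitFlowDefined X z} :=
  contDiffOn_infty.2 fun m => contDiffOn_nat_timeOneMap m hX

end Variation

section Flow

variable {E : Type*} [NormedAddCommGroup E] [NormedSpace ℝ E]

/-- The suspension of `X`: time becomes an additional, constant coordinate, so that the flow of
`X` at variable times is the time-one map of a single field. -/
def suspension (X : E → E) (q : E × ℝ) : E × ℝ := (q.2 • X q.1, 0)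

theorem contDiff_suspension {X : E → E} {m : WithTop ℕ∞} (hX : ContDiff ℝ m X) :
    ContDiff ℝ m (suspension X) :=
  (contDiff_snd.smul (hX.comp contDiff_fst)).prodMk contDiff_const

theorem IsUnitCurve.suspension {X : E → E} {c : ℝ} {x : E} {γ : ℝ → E}
    (hγ : IsUnitCurve (c • X) x γ) : IsUnitCurve (suspension X) (x, c) fun t => (γ t, c) :=
  ⟨by simp only [hγ.1], fun t ht => (hγ.2 t ht).prodMk (hasDerivWithinAt_const t _ _)⟩

theorem unitFlowDefined_suspension_iff {X : E → E} {c : ℝ} {x : E} :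
    UnitFlowDefined (suspension X) (x, c) ↔ UnitFlowDefined (c • X) x := by
  refine ⟨fun ⟨q, hq₀, hq⟩ => ?_, fun ⟨γ, hγ⟩ => ⟨_, hγ.suspension⟩⟩
  have htime : IsUnitCurve (0 : ℝ → ℝ) c fun t => (q t).2 :=
    ⟨by simp only [hq₀], fun t ht => (hq t ht).snd⟩
  refine ⟨fun t => (q t).1, by simp only [hq₀], fun t ht => ?_⟩
  have hconst : (q t).2 = c := htime.eqOn contDiff_const (isUnitCurve_const rfl) ht
  have hfst := (hq t ht).fst
  simp only [ContactSplitting.suspension, hconst] at hfst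
  exact hfst

theorem unitFlowDefined_zero_smul (X : E → E) (z : E) : UnitFlowDefined ((0 : ℝ) • X) z :=
  ⟨_, isUnitCurve_const (by simp)⟩

variable [FiniteDimensional ℝ E] {X : E → E}

theorem timeOneMap_zero_smul (X : E → E) (z : E) : timeOneMap ((0 : ℝ) • X) z = z :=
  (isUnitCurve_const (by simp)).timeOneMap_eq (by rw [zero_smul]; exact contDiff_const)

theorem timeOneMap_suspension (hX : ContDiff ℝ 1 X) {c : ℝ} {x : E}
    (h : UnitFlowDefined (c • X) x) :
    timeOneMap (suspension X) (x, c) = (timeOneMap (c • X) x, c) := by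
  obtain ⟨γ, hγ⟩ := h
  rw [hγ.suspension.timeOneMap_eq (contDiff_suspension hX),
    hγ.timeOneMap_eq (X := c • X) (hX.const_smul c)]

theorem isOpen_flowDomain (hX : ContDiff ℝ 1 X) :
    IsOpen {y : ℝ × E | UnitFlowDefined (y.1 • X) y.2} := by
  have h := (isOpen_setOf_unitFlowDefined (contDiff_suspension hX)).preimage
    (by fun_prop : Continuous fun y : ℝ × E => (y.2, y.1))
  simpa only [preimage_ofPred_eq, unitFlowDefined_suspension_iff] using h

theorem contDiffOn_timeOneMap_smul (hX : ContDiff ℝ ∞ X) :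
    ContDiffOn ℝ ∞ (fun y : ℝ × E => timeOneMap (y.1 • X) y.2)
      {y | UnitFlowDefined (y.1 • X) y.2} := by
  have h := (contDiffOn_timeOneMap (contDiff_suspension hX)).comp
    (f := (fun y => (y.2, y.1) : ℝ × E → E × ℝ)) (by fun_prop)
    (fun y hy => unitFlowDefined_suspension_iff.2 hy)
  refine h.fst.congr fun y hy => ?_
  simp only [Function.comp_apply, timeOneMap_suspension (hX.of_le (by simp)) hy]

theorem exists_local_integralCurves (hX : ContDiff ℝ 1 X) (z₀ : E) :
    ∃ ε > 0, ∀ᶠ z in 𝓝 z₀, ∃ γ : ℝ → E, γ 0 = z ∧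
      (∀ t, |t| < ε → HasDerivAt γ (X (γ t)) t) ∧
      ∀ t s, |t| + |s| < ε → timeOneMap (s • X) (γ t) = γ (t + s) := by
  obtain ⟨r, hr, ε, hε, h⟩ :=
    hX.contDiffAt.exists_forall_mem_closedBall_exists_eq_forall_mem_Ioo_hasDerivAt (x₀ := z₀) 0
  refine ⟨ε, hε, ?_⟩
  filter_upwards [closedBall_mem_nhds z₀ hr] with z hz
  obtain ⟨γ, h₀, hγ⟩ := h z hz
  refine ⟨γ, h₀, fun t ht => hγ t (by simpa using abs_lt.1 ht), fun t s hts => ?_⟩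
  have hmaps : MapsTo (fun u : ℝ => t + u * s) (Icc 0 1) (Ioo (0 - ε) (0 + ε)) := by
    intro u hu
    have hle : |t + u * s| ≤ |t| + |s| := by
      refine (abs_add_le _ _).trans ?_
      rw [abs_mul, abs_of_nonneg hu.1]
      gcongr
      exact mul_le_of_le_one_left (abs_nonneg s) hu.2
    simpa using abs_lt.1 (hle.trans_lt hts)
  have hcurve : IsUnitCurve (s • X) (γ t) fun u => γ (t + u * s) :=
    ⟨by simp, isIntegralCurveOn_comp_affine (fun u hu => (hγ u hu).hasDerivWithinAt) t s hmaps⟩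
  rw [hcurve.timeOneMap_eq (X := s • X) (hX.const_smul s), one_mul]

theorem hasDerivAt_timeOneMap_smul_zero (hX : ContDiff ℝ 1 X) (z : E) :
    HasDerivAt (fun t : ℝ => timeOneMap (t • X) z) (X z) 0 := by
  obtain ⟨ε, hε, h⟩ := exists_local_integralCurves hX z
  obtain ⟨γ, h₀, hγ, hmap⟩ := h.self_of_nhds
  have hderiv : HasDerivAt γ (X z) 0 := by simpa [h₀] using hγ 0 (by simpa using hε)
  refine hderiv.congr_of_eventuallyEq ?_
  filter_upwards [ball_mem_nhds (0 : ℝ) hε] with t ht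
  simpa [h₀] using hmap 0 t (by simpa using ht)

theorem eventually_timeOneMap_add_smul (hX : ContDiff ℝ 1 X) (z₀ : E) :
    ∃ ε > 0, ∀ᶠ z in 𝓝 z₀, ∀ t s : ℝ, |t| + |s| < ε →
      timeOneMap (s • X) (timeOneMap (t • X) z) = timeOneMap ((t + s) • X) z := by
  obtain ⟨ε, hε, h⟩ := exists_local_integralCurves hX z₀
  refine ⟨ε, hε, h.mono fun z ⟨γ, h₀, _, hmap⟩ t s hts => ?_⟩
  have ht := hmap 0 t (by simpa using lt_of_le_of_lt (le_add_of_nonneg_right (abs_nonneg s)) hts)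
  have hadd := hmap 0 (t + s) (by simpa using (abs_add_le t s).trans_lt hts)
  rw [h₀, zero_add] at ht hadd
  rw [ht, hadd, hmap t s hts]

end Flow

section JetFlow

variable {n : ℕ} {X : Jet n → Jet n} {t : ℝ} {z : Jet n}

theorem Solves.isUnitCurve {γ : ℝ → Jet n} (hγ : Solves X z t γ) :
    IsUnitCurve (t • X) z fun u => γ (0 + u * t) := by
  refine ⟨by simpa using hγ.1, isIntegralCurveOn_comp_affine hγ.2 0 t fun u hu => ?_⟩
  simpa using (convex_uIcc (0 : ℝ) t).smul_mem_of_zero_mem left_mem_uIcc right_mem_uIcc hu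

theorem IsUnitCurve.solves {γ : ℝ → Jet n} (ht : t ≠ 0) (hγ : IsUnitCurve (t • X) z γ) :
    Solves X z t fun s => γ (0 + s * t⁻¹) := by
  have hmaps : MapsTo (fun s : ℝ => 0 + s * t⁻¹) (uIcc 0 t) (Icc 0 1) := fun s hs => by
    rw [← segment_eq_uIcc, segment_eq_image] at hs
    obtain ⟨θ, hθ, rfl⟩ := hs
    simpa [ht] using hθ
  refine ⟨by simpa using hγ.1, ?_⟩
  simpa [inv_smul_smul₀ ht] using isIntegralCurveOn_comp_affine hγ.2 0 t⁻¹ hmaps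

theorem flowDefined_iff : FlowDefined X t z ↔ UnitFlowDefined (t • X) z := by
  refine ⟨fun ⟨γ, hγ⟩ => ⟨_, hγ.isUnitCurve⟩, fun ⟨γ, hγ⟩ => ?_⟩
  rcases eq_or_ne t 0 with rfl | ht
  · refine ⟨fun _ => z, rfl, fun s _ => ?_⟩
    rw [uIcc_self]
    exact hasDerivWithinAt_iff_hasFDerivWithinAt.2 (.of_finite (finite_singleton _))
  · exact ⟨_, hγ.solves ht⟩

theorem flow_eq_timeOneMap (hX : ContDiff ℝ 1 X) (t : ℝ) (z : Jet n) :
    flow X t z = timeOneMap (t • X) z := by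
  by_cases h : FlowDefined X t z
  · rw [flow, dif_pos h,
      h.choose_spec.isUnitCurve.timeOneMap_eq (X := t • X) (hX.const_smul t), zero_add, one_mul]
  · rw [flow, dif_neg h, timeOneMap, dif_neg fun h' => h (flowDefined_iff.2 h')]

end JetFlow

/-- The neighbourhoods of the slice `τ = 0` in the space of pairs `(τ, z)`: `f =ᶠ[timeZero E] g`
says that the families of maps `f` and `g` have the same germ at parameter zero. -/
def timeZero (E : Type*) [TopologicalSpace E] : Filter (ℝ × E) := 𝓝ˢ {y | y.1 = 0}

theorem eventually_timeZero {E : Type*} [TopologicalSpace E] {P : ℝ × E → Prop} :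
    (∀ᶠ y in timeZero E, P y) ↔ ∀ z, ∀ᶠ y in 𝓝 (0, z), P y :=
  eventually_nhdsSet_iff_forall.trans
    ⟨fun h z => h (0, z) rfl, by rintro h ⟨_, z⟩ rfl; exact h z⟩

theorem tendsto_prodMap_timeZero {E : Type*} [TopologicalSpace E] {t : ℝ → ℝ}
    (ht : Tendsto t (𝓝 0) (𝓝 0)) :
    Tendsto (Prod.map t id) (timeZero E) (timeZero E) := fun _ hs =>
  eventually_timeZero.2 fun z => by
    have h := eventually_timeZero.1 hs z
    rw [nhds_prod_eq] at h ⊢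
    exact (ht.prodMap tendsto_id) h

theorem tendsto_reparam_timeZero {E : Type*} [TopologicalSpace E] (a : ℝ) {m : ℕ} (hm : m ≠ 0) :
    Tendsto (fun y : ℝ × E => (a * y.1 ^ m, y.2)) (timeZero E) (timeZero E) :=
  tendsto_prodMap_timeZero (t := fun τ => a * τ ^ m) (by
    have ht : Continuous fun τ : ℝ => a * τ ^ m := by fun_prop
    simpa only [zero_pow hm, mul_zero] using ht.tendsto 0)

theorem tendsto_prodMk_timeZero {E F : Type*} [TopologicalSpace E] [TopologicalSpace F]
    {g : ℝ × E → F} (hg : ∀ z, ContinuousAt g (0, z)) :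
    Tendsto (fun y => (y.1, g y)) (timeZero E) (timeZero F) := fun _ hs =>
  eventually_timeZero.2 fun z => (continuousAt_fst.prodMk (hg z)).eventually
    (eventually_timeZero.1 hs (g (0, z)))

theorem prod_nhdsSet_le_timeZero {E : Type*} [TopologicalSpace E] {U : Set E}
    (hU : IsCompact U) : 𝓝 (0 : ℝ) ×ˢ 𝓝ˢ U ≤ timeZero E := by
  rw [← nhdsSet_singleton, ← isCompact_singleton.nhdsSet_prod_eq hU]
  exact nhdsSet_mono fun y hy => hy.1

section Germs

variable {E F G : Type*} [NormedAddCommGroup E] [NormedSpace ℝ E] [NormedAddCommGroup F]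
  [NormedSpace ℝ F] [NormedAddCommGroup G] [NormedSpace ℝ G] {p q : ℕ}

/-- Families of maps `f (τ, ·)` that are jointly smooth in parameter and point near `τ = 0`. -/
def SmoothGerm (f : ℝ × E → F) : Prop := ∀ z, ContDiffAt ℝ ∞ f (0, z)

/-- Congruence of families modulo `τ ^ p`, with a smooth family as quotient. -/
def CongrMod (p : ℕ) (f g : ℝ × E → F) : Prop :=
  ∃ R : ℝ × E → F, SmoothGerm R ∧ f =ᶠ[timeZero E] fun y => g y + y.1 ^ p • R y

/-- The family `f` run at the parameter `a * τ ^ m`. -/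
def reparam (a : ℝ) (m : ℕ) (f : ℝ × E → F) (y : ℝ × E) : F := f (a * y.1 ^ m, y.2)

/-- Composition of families of maps, parameter by parameter. -/
def compose (f : ℝ × F → G) (g : ℝ × E → F) (y : ℝ × E) : G := f (y.1, g y)

theorem SmoothGerm.add {f g : ℝ × E → F} (hf : SmoothGerm f) (hg : SmoothGerm g) :
    SmoothGerm (fun y => f y + g y) := fun z => (hf z).add (hg z)

theorem SmoothGerm.pow_smul {f : ℝ × E → F} (hf : SmoothGerm f) (p : ℕ) :
    SmoothGerm (fun y => y.1 ^ p • f y) := fun z => (contDiffAt_fst.pow p).smul (hf z)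

theorem SmoothGerm.comp {f : ℝ × F → G} {g : ℝ × E → F} (hf : SmoothGerm f) (hg : SmoothGerm g) :
    SmoothGerm (compose f g) := fun z =>
  ContDiffAt.comp (g := f) (f := fun y => (y.1, g y)) (0, z) (hf (g (0, z)))
    (contDiffAt_fst.prodMk (hg z))

theorem SmoothGerm.reparam {f : ℝ × E → F} (hf : SmoothGerm f) (a : ℝ) {m : ℕ} (hm : m ≠ 0) :
    SmoothGerm (reparam a m f) := fun z =>
  ContDiffAt.comp (g := f) (f := fun y : ℝ × E => (a * y.1 ^ m, y.2)) (0, z)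
    (by simpa [hm] using hf z) (by fun_prop)

theorem SmoothGerm.congr {f g : ℝ × E → F} (hf : SmoothGerm f) (h : g =ᶠ[timeZero E] f) :
    SmoothGerm g :=
  fun z => (hf z).congr_of_eventuallyEq (eventually_timeZero.1 h z)

theorem smoothGerm_snd : SmoothGerm (fun y : ℝ × E => y.2) := fun _ => contDiffAt_snd

theorem smoothGerm_of_contDiff {e : E → F} (he : ContDiff ℝ ∞ e) : SmoothGerm (fun y => e y.2) :=
  fun _ => he.contDiffAt.comp _ contDiffAt_snd

theorem SmoothGerm.contDiff_zero {f : ℝ × E → F} (hf : SmoothGerm f) :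
    ContDiff ℝ ∞ (fun z => f (0, z)) :=
  contDiff_iff_contDiffAt.2 fun z => (hf z).comp z (contDiffAt_const.prodMk contDiffAt_id)

theorem SmoothGerm.tendsto {g : ℝ × E → F} (hg : SmoothGerm g) :
    Tendsto (fun y => (y.1, g y)) (timeZero E) (timeZero F) :=
  tendsto_prodMk_timeZero fun z => (hg z).continuousAt

theorem congrMod_of_eventuallyEq {f g : ℝ × E → F} (h : f =ᶠ[timeZero E] g) (p : ℕ) :
    CongrMod p f g :=
  ⟨fun _ => 0, fun _ => contDiffAt_const, h.mono fun y hy => by simp [hy]⟩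

theorem congrMod_add_pow_smul {R : ℝ × E → F} (hR : SmoothGerm R) (p : ℕ) (g : ℝ × E → F) :
    CongrMod p (fun y => g y + y.1 ^ p • R y) g :=
  ⟨R, hR, .rfl⟩

theorem CongrMod.refl (p : ℕ) (f : ℝ × E → F) : CongrMod p f f :=
  congrMod_of_eventuallyEq .rfl p

theorem CongrMod.symm {f g : ℝ × E → F} (h : CongrMod p f g) : CongrMod p g f := by
  obtain ⟨R, hR, h⟩ := h
  exact ⟨fun y => -R y, fun z => (hR z).neg, h.mono fun y hy => by simp [hy]⟩

theorem CongrMod.trans {f g k : ℝ × E → F} (h : CongrMod p f g) (h' : CongrMod p g k) :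
    CongrMod p f k := by
  obtain ⟨R, hR, h⟩ := h
  obtain ⟨R', hR', h'⟩ := h'
  refine ⟨fun y => R' y + R y, hR'.add hR, ?_⟩
  filter_upwards [h, h'] with y hy hy'
  rw [hy, hy', smul_add, add_assoc]

instance : @Trans (ℝ × E → F) (ℝ × E → F) (ℝ × E → F) (CongrMod p) (CongrMod p) (CongrMod p) :=
  ⟨CongrMod.trans⟩

theorem CongrMod.add {f g f' g' : ℝ × E → F} (h : CongrMod p f g) (h' : CongrMod p f' g') :
    CongrMod p (fun y => f y + f' y) (fun y => g y + g' y) := by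
  obtain ⟨R, hR, h⟩ := h
  obtain ⟨R', hR', h'⟩ := h'
  refine ⟨fun y => R y + R' y, hR.add hR', ?_⟩
  filter_upwards [h, h'] with y hy hy'
  rw [hy, hy', smul_add, add_add_add_comm]

theorem CongrMod.of_le (hpq : p ≤ q) {f g : ℝ × E → F} (h : CongrMod q f g) : CongrMod p f g := by
  obtain ⟨R, hR, h⟩ := h
  refine ⟨_, hR.pow_smul (q - p), h.mono fun y hy => ?_⟩
  simp only [hy, smul_smul, ← pow_add, Nat.add_sub_cancel' hpq]

theorem CongrMod.pow_smul {f g : ℝ × E → F} (h : CongrMod p f g) (q : ℕ) :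
    CongrMod (q + p) (fun y => y.1 ^ q • f y) (fun y => y.1 ^ q • g y) := by
  obtain ⟨R, hR, h⟩ := h
  refine ⟨R, hR, h.mono fun y hy => ?_⟩
  simp only [hy, smul_add, smul_smul, ← pow_add]

theorem CongrMod.smoothGerm {f g : ℝ × E → F} (h : CongrMod p f g) (hg : SmoothGerm g) :
    SmoothGerm f := by
  obtain ⟨R, hR, h⟩ := h
  exact (hg.add (hR.pow_smul p)).congr h

theorem CongrMod.comp_left {f f' : ℝ × F → G} {g : ℝ × E → F} (h : CongrMod p f f')
    (hg : SmoothGerm g) : CongrMod p (compose f g) (compose f' g) := by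
  obtain ⟨R, hR, h⟩ := h
  exact ⟨_, hR.comp hg, hg.tendsto.eventually h⟩

theorem CongrMod.reparam {f g : ℝ × E → F} (h : CongrMod p f g) (a : ℝ) {m : ℕ} (hm : m ≠ 0) :
    CongrMod (m * p) (reparam a m f) (reparam a m g) := by
  obtain ⟨R, hR, h⟩ := h
  refine ⟨fun y => a ^ p • ContactSplitting.reparam a m R y,
    fun z => (hR.reparam a hm z).const_smul _,
    ((tendsto_reparam_timeZero a hm).eventually h).mono fun y hy => ?_⟩
  simp only [ContactSplitting.reparam, hy, mul_pow, smul_smul, ← pow_mul, mul_comm (a ^ p)]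

section Taylor

variable [FiniteDimensional ℝ E] [CompleteSpace F]

theorem SmoothGerm.paramSlope {f : ℝ × E → F} (hf : SmoothGerm f) : SmoothGerm (paramSlope f) :=
  fun z => contDiffAt_infty_paramSlope (hf z)

theorem congrMod_one {f : ℝ × E → F} (hf : SmoothGerm f) :
    CongrMod 1 f (fun y => f (0, y.2)) :=
  ⟨_, hf.paramSlope, .of_forall fun y => by
    simpa only [pow_one] using eq_add_smul_paramSlope f y⟩

theorem congrMod_two {f : ℝ × E → F} (hf : SmoothGerm f) {e : E → F}
    (he : ∀ z, HasDerivAt (fun τ => f (τ, z)) (e z) 0) :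
    CongrMod 2 f (fun y => f (0, y.2) + y.1 • e y.2) := by
  have hslope : CongrMod 1 (ContactSplitting.paramSlope f) (fun y => e y.2) := by
    simpa only [paramSlope_zero, (he _).deriv] using congrMod_one hf.paramSlope
  calc f = fun y => f (0, y.2) + y.1 ^ 1 • ContactSplitting.paramSlope f y := by
        ext1 y; rw [pow_one]; exact eq_add_smul_paramSlope f y
    CongrMod 2 _ (fun y => f (0, y.2) + y.1 ^ 1 • e y.2) :=
        (CongrMod.refl 2 _).add (hslope.pow_smul 1)
    _ = _ := by simp only [pow_one]

theorem CongrMod.exists_coeff {f g : ℝ × E → F} (h : CongrMod p f g) :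
    ∃ e : E → F, ContDiff ℝ ∞ e ∧ CongrMod (p + 1) f (fun y => g y + y.1 ^ p • e y.2) := by
  obtain ⟨R, hR, h⟩ := h
  exact ⟨fun z => R (0, z), hR.contDiff_zero, (congrMod_of_eventuallyEq h _).trans
    ((CongrMod.refl _ g).add ((congrMod_one hR).pow_smul p))⟩

end Taylor

/-- The Hadamard quotient of `(σ, t, x, r) ↦ f (t, x + σ r)`, evaluated at `σ = τ ^ p`, is the
quotient of the two compositions. -/
theorem CongrMod.comp_right [FiniteDimensional ℝ F] [CompleteSpace G] (hp : p ≠ 0)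
    {f : ℝ × F → G} (hf : SmoothGerm f) {g g' : ℝ × E → F} (h : CongrMod p g g')
    (hg' : SmoothGerm g') : CongrMod p (compose f g) (compose f g') := by
  obtain ⟨R, hR, h⟩ := h
  let k : ℝ × (ℝ × F × F) → G := fun w => f (w.2.1, w.2.2.1 + w.1 • w.2.2.2)
  let κ : ℝ × E → ℝ × (ℝ × F × F) := fun y => (y.1 ^ p, y.1, g' y, R y)
  have hk (z : E) : ContDiffAt ℝ ∞ k (0, 0, g' (0, z), R (0, z)) := by
    refine ContDiffAt.comp (g := f) (f := fun w : ℝ × (ℝ × F × F) =>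
      (w.2.1, w.2.2.1 + w.1 • w.2.2.2)) _ ?_ (by fun_prop)
    simpa using hf (g' (0, z))
  refine ⟨fun y => paramSlope k (κ y), fun z => ?_, h.mono fun y hy => ?_⟩
  · refine ContDiffAt.comp (g := paramSlope k) (f := κ) (0, z) ?_
      ((contDiffAt_fst.pow p).prodMk (contDiffAt_fst.prodMk ((hg' z).prodMk (hR z))))
    simpa [κ, hp] using contDiffAt_infty_paramSlope (hk z)
  · simpa [compose, k, κ, hy] using eq_add_smul_paramSlope k (κ y)

/-- Families of maps of a space to itself that are smooth and start at the identity. -/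
def NearId (S : ℝ × E → E) : Prop := SmoothGerm S ∧ ∀ z, S (0, z) = z

theorem NearId.comp {S T : ℝ × E → E} (hS : NearId S) (hT : NearId T) : NearId (compose S T) :=
  ⟨hS.1.comp hT.1, fun z => by simp only [compose, hS.2, hT.2]⟩

theorem NearId.reparam {S : ℝ × E → E} (hS : NearId S) (a : ℝ) {m : ℕ} (hm : m ≠ 0) :
    NearId (reparam a m S) :=
  ⟨hS.1.reparam a hm, fun z => by
    simp only [ContactSplitting.reparam, zero_pow hm, mul_zero, hS.2]⟩

theorem nearId_snd : NearId fun y : ℝ × E => y.2 := ⟨smoothGerm_snd, fun _ => rfl⟩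

section Expansions

variable [FiniteDimensional ℝ E]

theorem NearId.congrMod {S : ℝ × E → E} (hS : NearId S) : CongrMod 1 S (fun y => y.2) := by
  simpa only [hS.2] using congrMod_one hS.1

theorem NearId.congrMod_two {S : ℝ × E → E} (hS : NearId S) {a : E → E}
    (ha : ∀ z, HasDerivAt (fun τ => S (τ, z)) (a z) 0) :
    CongrMod 2 S (fun y => y.2 + y.1 • a y.2) := by
  simpa only [hS.2] using ContactSplitting.congrMod_two hS.1 ha

theorem NearId.comp_add (hp : p ≠ 0) {S : ℝ × E → E} (hS : NearId S) {k r : ℝ × E → E}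
    (hk : SmoothGerm k) (hr : SmoothGerm r) :
    CongrMod (p + 1) (compose S (fun y => k y + y.1 ^ p • r y))
      (fun y => compose S k y + y.1 ^ p • r y) := by
  have eq_slope (u : ℝ × E → E) (y : ℝ × E) :
      compose S u y = u y + y.1 ^ 1 • compose (paramSlope S) u y := by
    simpa only [compose, hS.2, pow_one] using eq_add_smul_paramSlope S (y.1, u y)
  have hslope := ((congrMod_add_pow_smul hr p k).comp_right hp hS.1.paramSlope hk).pow_smul 1
  rw [add_comm 1 p] at hslope
  calc compose S (fun y => k y + y.1 ^ p • r y)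
      = _ := funext (eq_slope _)
    CongrMod (p + 1) _ _ := (CongrMod.refl (p + 1) fun y => k y + y.1 ^ p • r y).add hslope
    _ = _ := by ext1 y; rw [eq_slope k, add_right_comm]

theorem CongrMod.comp_coeff [CompleteSpace F] {e : E → F} (he : ContDiff ℝ ∞ e) {g : ℝ × E → E}
    (hg : CongrMod 1 g (fun y => y.2)) : CongrMod 1 (fun y => e (g y)) (fun y => e y.2) :=
  hg.comp_right one_ne_zero (f := fun y : ℝ × E => e y.2) (smoothGerm_of_contDiff he)
    smoothGerm_snd

theorem CongrMod.comp_expansion (hp : p ≠ 0) {S S' f g : ℝ × E → E} {e e' : E → E}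
    (hS : NearId S) (hS' : NearId S') (he : ContDiff ℝ ∞ e) (he' : ContDiff ℝ ∞ e')
    (hf : CongrMod (p + 1) f (fun y => S y + y.1 ^ p • e y.2))
    (hg : CongrMod (p + 1) g (fun y => S' y + y.1 ^ p • e' y.2)) :
    CongrMod (p + 1) (compose f g) (fun y => compose S S' y + y.1 ^ p • (e y.2 + e' y.2)) := by
  have he'_germ := smoothGerm_of_contDiff he'
  have hS'e' := hS'.1.add (he'_germ.pow_smul p)
  have hg_smooth : SmoothGerm g := hg.smoothGerm hS'e'
  have hg_id : CongrMod 1 g (fun y => y.2) :=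
    (hg.of_le (by lia)).trans
      (((congrMod_add_pow_smul he'_germ p S').of_le (by lia)).trans hS'.congrMod)
  calc CongrMod (p + 1) (compose f g) (fun y => compose S g y + y.1 ^ p • e (g y)) :=
        hf.comp_left hg_smooth
    CongrMod (p + 1) _ (fun y => compose S S' y + y.1 ^ p • e' y.2 + y.1 ^ p • e y.2) :=
        ((hg.comp_right p.succ_ne_zero hS.1 hS'e').trans (hS.comp_add hp hS'.1 he'_germ)).add
          ((hg_id.comp_coeff he).pow_smul p)
    _ = _ := by ext1 y; rw [smul_add, add_assoc, add_comm (y.1 ^ p • e y.2)]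

theorem congrMod_of_leftInverse_of_rightInverse (hp : p ≠ 0) {f g k : ℝ × E → E}
    (hk : SmoothGerm k) (hfk : CongrMod p (compose f k) (fun y => y.2)) (hg : SmoothGerm g)
    (hgf : compose g f =ᶠ[timeZero E] fun y => y.2) : CongrMod p g k :=
  calc CongrMod p g (compose g (compose f k)) := (hfk.comp_right hp hg smoothGerm_snd).symm
    CongrMod p _ k := congrMod_of_eventuallyEq (hgf.comp_tendsto hk.tendsto) _

theorem CongrMod.inverse_expansion (hp : p ≠ 0) {S S' f g : ℝ × E → E} {e : E → E}
    (hS : NearId S) (hS' : NearId S') (he : ContDiff ℝ ∞ e)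
    (hf : CongrMod (p + 1) f (fun y => S y + y.1 ^ p • e y.2))
    (hSS' : compose S S' =ᶠ[timeZero E] fun y => y.2) (hg : SmoothGerm g)
    (hgf : compose g f =ᶠ[timeZero E] fun y => y.2) :
    CongrMod (p + 1) g (fun y => S' y + y.1 ^ p • (-e y.2)) := by
  refine congrMod_of_leftInverse_of_rightInverse p.succ_ne_zero
    (hS'.1.add ((smoothGerm_of_contDiff he.neg).pow_smul p)) ?_ hg hgf
  exact (CongrMod.comp_expansion hp hS hS' he he.neg hf (.refl _ _)).trans
    (congrMod_of_eventuallyEq (hSS'.mono fun y hy => by simp [hy]) _)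

theorem CongrMod.comp_contDiff_two [CompleteSpace F] {a : E → F} {b : E → E} {B : ℝ × E → E}
    (ha : ContDiff ℝ ∞ a) (hb : ContDiff ℝ ∞ b)
    (hB : CongrMod 2 B (fun y => y.2 + y.1 • b y.2)) :
    CongrMod 2 (fun y => a (B y)) (fun y => a y.2 + y.1 • fderiv ℝ a y.2 (b y.2)) := by
  have ha_germ := smoothGerm_of_contDiff ha
  have hline : SmoothGerm (fun y : ℝ × E => y.2 + y.1 • b y.2) := by
    simpa only [pow_one] using smoothGerm_snd.add ((smoothGerm_of_contDiff hb).pow_smul 1)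
  have hderiv (z : E) : HasDerivAt (fun τ : ℝ => a (z + τ • b z)) (fderiv ℝ a z (b z)) 0 := by
    have hstraight : HasDerivAt (fun τ : ℝ => z + τ • b z) (b z) 0 := by
      simpa using ((hasDerivAt_id (0 : ℝ)).smul_const (b z)).const_add z
    exact HasFDerivAt.comp_hasDerivAt 0
      (by simpa using (ha.differentiable (by simp) z).hasFDerivAt) hstraight
  calc CongrMod 2 (fun y => a (B y)) (fun y => a (y.2 + y.1 • b y.2)) :=
        hB.comp_right two_ne_zero (f := fun y : ℝ × E => a y.2) ha_germ hline
    CongrMod 2 _ (fun y => a (y.2 + (0 : ℝ) • b y.2) + y.1 • fderiv ℝ a y.2 (b y.2)) :=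
        ContactSplitting.congrMod_two (ha_germ.comp hline) hderiv
    _ = _ := by simp only [zero_smul, add_zero]

theorem CongrMod.comp_second_order {A B : ℝ × E → E} {a b q r : E → E}
    (ha : ContDiff ℝ ∞ a) (hb : ContDiff ℝ ∞ b) (hq : ContDiff ℝ ∞ q) (hB : NearId B)
    (hAq : CongrMod 3 A (fun y => y.2 + y.1 • a y.2 + y.1 ^ 2 • q y.2))
    (hBr : CongrMod 3 B (fun y => y.2 + y.1 • b y.2 + y.1 ^ 2 • r y.2))
    (hBb : CongrMod 2 B (fun y => y.2 + y.1 • b y.2)) :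
    CongrMod 3 (compose A B) (fun y => (y.2 + y.1 • (a y.2 + b y.2) + y.1 ^ 2 • (q y.2 + r y.2)) +
      y.1 ^ 2 • fderiv ℝ a y.2 (b y.2)) := by
  have haB := (hBb.comp_contDiff_two ha hb).pow_smul 1
  have hqB := (hB.congrMod.comp_coeff hq).pow_smul 2
  calc CongrMod 3 (compose A B) (fun y => B y + y.1 • a (B y) + y.1 ^ 2 • q (B y)) :=
        hAq.comp_left hB.1
    _ = fun y => B y + y.1 ^ 1 • a (B y) + y.1 ^ 2 • q (B y) := by simp only [pow_one]
    CongrMod 3 _ _ := (hBr.add haB).add hqB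
    _ = _ := by
        ext1 y
        simp only [pow_one, smul_add, smul_smul, pow_two]
        abel

/-- With `e` the bracket, both `A ∘ B` and `(B ∘ A) ∘ (id + τ² e)` have the same second-order
expansion; cancelling `B ∘ A` gives the claim. -/
theorem commutator_expansion {A B A' B' : ℝ × E → E} {a b : E → E}
    (ha : ContDiff ℝ ∞ a) (hb : ContDiff ℝ ∞ b) (hA : NearId A) (hB : NearId B)
    (hA' : SmoothGerm A') (hB' : SmoothGerm B')
    (hAa : ∀ z, HasDerivAt (fun τ => A (τ, z)) (a z) 0)
    (hBb : ∀ z, HasDerivAt (fun τ => B (τ, z)) (b z) 0)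
    (hAA : compose A' A =ᶠ[timeZero E] fun y => y.2)
    (hBB : compose B' B =ᶠ[timeZero E] fun y => y.2) :
    CongrMod 3 (compose A' (compose B' (compose A B)))
      (fun y => y.2 + y.1 ^ 2 • VectorField.lieBracket ℝ b a y.2) := by
  have hA2 := hA.congrMod_two hAa
  have hB2 := hB.congrMod_two hBb
  obtain ⟨q, hq, hA3⟩ := hA2.exists_coeff
  obtain ⟨r, hr, hB3⟩ := hB2.exists_coeff
  let e : E → E := VectorField.lieBracket ℝ b a
  have he : ContDiff ℝ ∞ e := hb.lieBracket_vectorField ha (by simp)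
  let k : ℝ × E → E := fun y => y.2 + y.1 ^ 2 • e y.2
  have hk : SmoothGerm k := smoothGerm_snd.add ((smoothGerm_of_contDiff he).pow_smul 2)
  have hAB : CongrMod 3 (compose A B) (compose (compose B A) k) := by
    have hAB := CongrMod.comp_second_order ha hb hq hB hA3 hB3 hB2
    have hBA := CongrMod.comp_second_order hb ha hr hA hB3 hA3 hA2
    refine CongrMod.trans ?_
      ((hB.comp hA).comp_add two_ne_zero smoothGerm_snd (smoothGerm_of_contDiff he)).symm
    calc CongrMod 3 (compose A B) _ := hAB
      _ = fun y => _ + y.1 ^ 2 • e y.2 := by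
          ext1 y
          simp only [e, VectorField.lieBracket_eq, smul_sub, smul_add]
          abel
      CongrMod 3 _ _ := hBA.symm.add (CongrMod.refl 3 fun y : ℝ × E => y.1 ^ 2 • e y.2)
  have hcancel : compose (compose A' B') (compose B A) =ᶠ[timeZero E] fun y => y.2 := by
    filter_upwards [hBB.comp_tendsto hA.1.tendsto, hAA] with y hy hy'
    simp only [compose, Function.comp_apply] at hy hy' ⊢
    rw [hy, hy']
  calc CongrMod 3 (compose (compose A' B') (compose A B))
        (compose (compose A' B') (compose (compose B A) k)) :=
        hAB.comp_right three_ne_zero (hA'.comp hB') ((hB.comp hA).1.comp hk)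
    CongrMod 3 _ k := congrMod_of_eventuallyEq (hcancel.comp_tendsto hk.tendsto) 3

end Expansions

end Germs

theorem fderiv_lieBracket_apply {E : Type*} [NormedAddCommGroup E] [NormedSpace ℝ E] {X Y : E → E}
    (hX : ContDiff ℝ 2 X) (hY : ContDiff ℝ 2 Y) (z w : E) :
    fderiv ℝ (VectorField.lieBracket ℝ X Y) z w =
      (fderiv ℝ (fderiv ℝ Y) z (X z) w + fderiv ℝ Y z (fderiv ℝ X z w)) -
        (fderiv ℝ (fderiv ℝ X) z (Y z) w + fderiv ℝ X z (fderiv ℝ Y z w)) := by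
  have hsymm {Z : E → E} (hZ : ContDiff ℝ 2 Z) (v w : E) :
      fderiv ℝ (fderiv ℝ Z) z v w = fderiv ℝ (fderiv ℝ Z) z w v :=
    (hZ.contDiffAt.isSymmSndFDerivAt (by simp)).eq v w
  have hdiff {Z : E → E} (hZ : ContDiff ℝ 2 Z) : DifferentiableAt ℝ Z z :=
    hZ.differentiable (by simp) z
  have hdiff' {Z : E → E} (hZ : ContDiff ℝ 2 Z) : DifferentiableAt ℝ (fderiv ℝ Z) z :=
    (hZ.fderiv_right (m := 1) (by norm_num)).differentiable (by simp) z
  have hbracket : HasFDerivAt (VectorField.lieBracket ℝ X Y) _ z :=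
    ((hdiff' hY).hasFDerivAt.clm_apply (hdiff hX).hasFDerivAt).sub
      ((hdiff' hX).hasFDerivAt.clm_apply (hdiff hY).hasFDerivAt)
  rw [hbracket.fderiv, hsymm hY (X z) w, hsymm hX (Y z) w]
  simp [add_comm]

section ContactGeometry

variable {n : ℕ} {H K : Jet n → ℝ} {X Y : Jet n → Jet n} {μ ν : Jet n → ℝ}

/-- The bilinear form `(z, w) ↦ ∑ᵢ pᵢ(z) xⁱ(w)`, so that `α_z = du - momentumPairing z`. -/
def momentumPairing : Jet n →L[ℝ] Jet n →L[ℝ] ℝ :=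
  ∑ i, ((ContinuousLinearMap.proj i).comp ((ContinuousLinearMap.snd ℝ ℝ (Fin n → ℝ)).comp
    (ContinuousLinearMap.snd ℝ (Fin n → ℝ) (ℝ × (Fin n → ℝ))))).smulRight
      ((ContinuousLinearMap.proj (R := ℝ) (φ := fun _ : Fin n => ℝ) i).comp
        (ContinuousLinearMap.fst ℝ (Fin n → ℝ) (ℝ × (Fin n → ℝ))))

theorem momentumPairing_apply (z w : Jet n) : momentumPairing z w = ∑ i, z.2.2 i * w.1 i := by
  simp [momentumPairing]

theorem contactForm_eq (z v : Jet n) : contactForm z v = v.2.1 - momentumPairing z v := by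
  rw [momentumPairing_apply, contactForm]

theorem contactForm_add (z v w : Jet n) :
    contactForm z (v + w) = contactForm z v + contactForm z w := by
  simp only [contactForm_eq, map_add, Prod.snd_add, Prod.fst_add]
  ring

theorem contactForm_sub (z v w : Jet n) :
    contactForm z (v - w) = contactForm z v - contactForm z w := by
  simp only [contactForm_eq, map_sub, Prod.snd_sub, Prod.fst_sub]
  ring

theorem contactForm_smul (z : Jet n) (c : ℝ) (v : Jet n) :
    contactForm z (c • v) = c * contactForm z v := by
  simp only [contactForm_eq, map_smul, Prod.smul_snd, Prod.smul_fst, smul_eq_mul]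
  ring

theorem hasDerivWithinAt_contactForm {γ η : ℝ → Jet n} {γ' η' : Jet n} {s : Set ℝ} {t : ℝ}
    (hγ : HasDerivWithinAt γ γ' s t) (hη : HasDerivWithinAt η η' s t) :
    HasDerivWithinAt (fun t => contactForm (γ t) (η t))
      (contactForm (γ t) η' - momentumPairing γ' (η t)) s t := by
  simp only [contactForm_eq]
  have hηu : HasDerivWithinAt (fun t => (η t).2.1) η'.2.1 s t := hη.snd.fst
  have hpair := ((momentumPairing (n := n)).hasFDerivAt.comp_hasDerivWithinAt t hγ).clm_apply hη
  exact (hηu.sub hpair).congr_deriv (by simp only [Function.comp_apply]; ring)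

theorem differentiableAt_contactForm {z : Jet n} (hY : DifferentiableAt ℝ Y z) :
    DifferentiableAt ℝ (fun z => contactForm z (Y z)) z := by
  simp only [contactForm_eq]
  fun_prop

theorem fderiv_contactForm_apply {z : Jet n} (hY : DifferentiableAt ℝ Y z) (w : Jet n) :
    fderiv ℝ (fun z => contactForm z (Y z)) z w =
      contactForm z (fderiv ℝ Y z w) - momentumPairing w (Y z) := by
  have hderiv : HasFDerivAt (fun z => (Y z).2.1 - momentumPairing z (Y z)) _ z :=
    hY.hasFDerivAt.snd.fst.sub (momentumPairing.hasFDerivAt.clm_apply hY.hasFDerivAt)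
  simp only [contactForm_eq]
  rw [hderiv.fderiv]
  simp [sub_sub]

theorem fderiv_apply_eq_sum (H : Jet n → ℝ) (z w : Jet n) :
    fderiv ℝ H z w = ∑ i, w.1 i * dx H i z + w.2.1 * du H z + ∑ i, w.2.2 i * dp H i z := by
  have sum_single (v : Fin n → ℝ) : ∑ i, v i • (Pi.single i 1 : Fin n → ℝ) = v := by
    simpa using (pi_eq_sum_univ' v).symm
  have hw : w = ∑ i, w.1 i • ((Pi.single i 1, 0, 0) : Jet n) + w.2.1 • ((0, 1, 0) : Jet n) +
      ∑ i, w.2.2 i • ((0, 0, Pi.single i 1) : Jet n) := by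
    refine Prod.ext ?_ (Prod.ext ?_ ?_)
    · simp [Prod.fst_sum, sum_single]
    · simp [Prod.fst_sum, Prod.snd_sum]
    · simp [Prod.snd_sum, sum_single]
  conv_lhs => rw [hw]
  simp only [map_add, map_sum, map_smul, smul_eq_mul, dx, du, dp]

theorem contDiff_fderiv_apply (hH : ContDiff ℝ ∞ H) (v : Jet n) :
    ContDiff ℝ ∞ (fun z => fderiv ℝ H z v) :=
  (hH.fderiv_right (by simp)).clm_apply contDiff_const

theorem contDiff_dx (hH : ContDiff ℝ ∞ H) (i : Fin n) : ContDiff ℝ ∞ (dx H i) :=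
  contDiff_fderiv_apply hH _

theorem contDiff_du (hH : ContDiff ℝ ∞ H) : ContDiff ℝ ∞ (du H) :=
  contDiff_fderiv_apply hH _

theorem contDiff_dp (hH : ContDiff ℝ ∞ H) (i : Fin n) : ContDiff ℝ ∞ (dp H i) :=
  contDiff_fderiv_apply hH _

theorem contDiff_contactField (hH : ContDiff ℝ ∞ H) : ContDiff ℝ ∞ (contactField H) := by
  have hdx := contDiff_dx hH
  have hdu := contDiff_du hH
  have hdp := contDiff_dp hH
  unfold contactField
  fun_prop

theorem contDiff_euler (hH : ContDiff ℝ ∞ H) : ContDiff ℝ ∞ (euler H) := by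
  have hdp := contDiff_dp hH
  unfold euler
  fun_prop

theorem contDiff_jacobi (hH : ContDiff ℝ ∞ H) (hK : ContDiff ℝ ∞ K) :
    ContDiff ℝ ∞ (jacobi H K) := by
  have hHx := contDiff_dx hH
  have hHp := contDiff_dp hH
  have hKx := contDiff_dx hK
  have hKp := contDiff_dp hK
  have hHu := contDiff_du hH
  have hKu := contDiff_du hK
  have hHe := contDiff_euler hH
  have hKe := contDiff_euler hK
  unfold jacobi poisson
  fun_prop

theorem contactForm_contactField (H : Jet n → ℝ) (z : Jet n) :
    contactForm z (contactField H z) = -H z := by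
  simp only [contactForm, contactField]
  ring

/-- Infinitesimal contact transformations: `L_X α = μ α`, with the Lie derivative written as
`(L_X α)_z w = α_z (DX_z w) - ∑ᵢ pᵢ(X_z) xⁱ(w)`. -/
def IsInfinitesimalContact (X : Jet n → Jet n) (μ : Jet n → ℝ) : Prop :=
  ∀ z w, contactForm z (fderiv ℝ X z w) - momentumPairing (X z) w = μ z * contactForm z w

theorem momentumPairing_contactField (H : Jet n → ℝ) (z w : Jet n) :
    momentumPairing (contactField H z) w =
      -∑ i, w.1 i * dx H i z - du H z * momentumPairing z w := by
  rw [momentumPairing_apply, momentumPairing_apply, Finset.mul_sum, ← Finset.sum_neg_distrib,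
    ← Finset.sum_sub_distrib]
  refine Finset.sum_congr rfl fun i _ => ?_
  simp only [contactField]
  ring

theorem isInfinitesimalContact_contactField (hH : ContDiff ℝ ∞ H) :
    IsInfinitesimalContact (contactField H) (fun z => -du H z) := fun z w => by
  have hα : contactForm z (fderiv ℝ (contactField H) z w) =
      momentumPairing w (contactField H z) - fderiv ℝ H z w := by
    have h := fderiv_contactForm_apply
      ((contDiff_contactField hH).differentiable (by simp) z) w
    simp only [contactForm_contactField, fderiv_fun_neg, neg_apply] at h
    linarith
  rw [hα, fderiv_apply_eq_sum, momentumPairing_contactField, contactForm_eq,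
    momentumPairing_apply w, contactField]
  ring

theorem IsInfinitesimalContact.smul (hX : IsInfinitesimalContact X μ) (c : ℝ) :
    IsInfinitesimalContact (c • X) (fun z => c * μ z) := fun z w => by
  rw [fderiv_const_smul_field, Pi.smul_apply, Pi.smul_apply, map_smul, smul_apply, smul_apply,
    contactForm_smul, smul_eq_mul, mul_assoc, ← hX z w]
  ring

theorem IsInfinitesimalContact.add (hX : IsInfinitesimalContact X μ)
    (hY : IsInfinitesimalContact Y ν) (hX' : Differentiable ℝ X) (hY' : Differentiable ℝ Y) :
    IsInfinitesimalContact (X + Y) (fun z => μ z + ν z) := fun z w => by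
  rw [fderiv_add (hX' z) (hY' z), add_apply, Pi.add_apply, map_add, add_apply, contactForm_add,
    add_mul, ← hX z w, ← hY z w]
  ring

theorem IsInfinitesimalContact.fderiv_fderiv (hX : IsInfinitesimalContact X μ)
    (hX' : ContDiff ℝ 2 X) (hμ : Differentiable ℝ μ) (z v w : Jet n) :
    contactForm z (fderiv ℝ (fderiv ℝ X) z v w) = momentumPairing v (fderiv ℝ X z w) +
      momentumPairing (fderiv ℝ X z v) w + fderiv ℝ μ z v * contactForm z w -
        μ z * momentumPairing v w := by
  have hXd : DifferentiableAt ℝ X z := hX'.differentiable (by simp) z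
  have hDX : DifferentiableAt ℝ (fderiv ℝ X) z :=
    (hX'.fderiv_right (m := 1) (by norm_num)).differentiable (by simp) z
  have hDXw : DifferentiableAt ℝ (fun z => fderiv ℝ X z w) z :=
    hDX.clm_apply (differentiableAt_const w)
  have hDDX : fderiv ℝ (fun z => fderiv ℝ X z w) z v = fderiv ℝ (fderiv ℝ X) z v w := by
    rw [fderiv_clm_apply hDX (differentiableAt_const w)]
    simp
  have hBX : HasFDerivAt (fun z => momentumPairing (X z) w)
      ((momentumPairing.flip w).comp (fderiv ℝ X z)) z :=
    (momentumPairing.flip w).hasFDerivAt.comp z hXd.hasFDerivAt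
  have hα_const : fderiv ℝ (fun z => contactForm z w) z v = -momentumPairing v w := by
    simpa [contactForm] using fderiv_contactForm_apply (differentiableAt_const (x := z) w) v
  have hderiv : fderiv ℝ (fun z => contactForm z (fderiv ℝ X z w) - momentumPairing (X z) w) z v =
      fderiv ℝ (fun z => μ z * contactForm z w) z v :=
    congrArg (fun g => fderiv ℝ g z v) (funext fun z => hX z w)
  rw [fderiv_fun_sub (differentiableAt_contactForm hDXw) hBX.differentiableAt,
    fderiv_fun_mul (hμ z) (differentiableAt_contactForm (differentiableAt_const w)), sub_apply,
    add_apply, smul_apply, smul_apply, hα_const, fderiv_contactForm_apply hDXw, hDDX, hBX.fderiv,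
    ContinuousLinearMap.comp_apply, ContinuousLinearMap.flip_apply] at hderiv
  simp only [smul_eq_mul] at hderiv
  linarith

/-- The second derivatives enter only through the differentiated identity `L_X α = μ α`; what it
leaves over is symmetric in `X` and `Y`. -/
theorem IsInfinitesimalContact.lieBracket (hX : IsInfinitesimalContact X μ)
    (hY : IsInfinitesimalContact Y ν) (hX' : ContDiff ℝ 2 X) (hY' : ContDiff ℝ 2 Y)
    (hμ : Differentiable ℝ μ) (hν : Differentiable ℝ ν) :
    IsInfinitesimalContact (VectorField.lieBracket ℝ X Y)
      (fun z => fderiv ℝ ν z (X z) - fderiv ℝ μ z (Y z)) := fun z w => by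
  rw [fderiv_lieBracket_apply hX' hY', VectorField.lieBracket_eq, contactForm_sub,
    contactForm_add, contactForm_add, hY.fderiv_fderiv hY' hν, hX.fderiv_fderiv hX' hμ, map_sub,
    sub_apply]
  linear_combination hY z (fderiv ℝ X z w) - hX z (fderiv ℝ Y z w) +
    ν z * hX z w - μ z * hY z w

theorem IsInfinitesimalContact.eq_contactField (hX : IsInfinitesimalContact X μ)
    (hX' : Differentiable ℝ X) (hH : ∀ z, contactForm z (X z) = -H z) : X = contactField H := by
  ext1 z
  have hDH (w : Jet n) : momentumPairing (X z) w =
      momentumPairing w (X z) - fderiv ℝ H z w - μ z * contactForm z w := by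
    have h := fderiv_contactForm_apply (hX' z) w
    simp only [hH, fderiv_fun_neg, neg_apply] at h
    linarith [hX z w]
  have hu : μ z = -du H z := by
    have h := hDH (0, 1, 0)
    simp [momentumPairing_apply, contactForm] at h
    rw [du]; linarith
  have hp (i : Fin n) : (X z).1 i = dp H i z := by
    have h := hDH (0, 0, Pi.single i 1)
    simp [momentumPairing_apply, contactForm, Pi.single_apply] at h
    rw [dp]; linarith
  have hx (i : Fin n) : (X z).2.2 i = -(dx H i z + z.2.2 i * du H z) := by
    have h := hDH (Pi.single i 1, 0, 0)
    simp [momentumPairing_apply, contactForm, Pi.single_apply, hu] at h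
    rw [dx]; linarith
  have hα := hH z
  simp only [contactForm, hp] at hα
  refine Prod.ext (funext hp) (Prod.ext ?_ (funext hx))
  simp only [contactField]
  linarith

theorem contactField_jacobi (hH : ContDiff ℝ ∞ H) (hK : ContDiff ℝ ∞ K) :
    contactField (jacobi H K) =
      VectorField.lieBracket ℝ (contactField H) (contactField K) := by
  have hXH := contDiff_contactField hH
  have hXK := contDiff_contactField hK
  have cH := isInfinitesimalContact_contactField hH
  have cK := isInfinitesimalContact_contactField hK
  have two_le_infty : (2 : WithTop ℕ∞) ≤ ∞ := WithTop.coe_le_coe.2 le_top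
  refine (IsInfinitesimalContact.eq_contactField (cH.lieBracket cK
    (hXH.of_le two_le_infty) (hXK.of_le two_le_infty)
    ((contDiff_du hH).neg.differentiable (by simp)) ((contDiff_du hK).neg.differentiable (by simp)))
    ((hXH.lieBracket_vectorField (m := ∞) hXK (by simp)).differentiable (by simp))
    fun z => ?_).symm
  have hHK := cH z (contactField K z)
  have hKH := cK z (contactField H z)
  rw [contactForm_contactField] at hHK hKH
  have hpoisson : poisson H K z = ∑ i, dp H i z * dx K i z - ∑ i, dp K i z * dx H i z := by
    simp only [poisson, Finset.sum_sub_distrib, mul_comm (dx H _ z)]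
  rw [momentumPairing_contactField, momentumPairing_apply] at hHK hKH
  rw [VectorField.lieBracket_eq, contactForm_sub, jacobi, hpoisson]
  simp only [euler]
  simp only [contactField] at hHK hKH ⊢
  linear_combination hKH - hHK

theorem contactField_add (hH : ContDiff ℝ ∞ H) (hK : ContDiff ℝ ∞ K) :
    contactField (H + K) = contactField H + contactField K := by
  have hXH := (contDiff_contactField hH).differentiable (by simp)
  have hXK := (contDiff_contactField hK).differentiable (by simp)
  refine (((isInfinitesimalContact_contactField hH).add (isInfinitesimalContact_contactField hK)
    hXH hXK).eq_contactField (hXH.add hXK) fun z => ?_).symm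
  rw [Pi.add_apply, contactForm_add, contactForm_contactField, contactForm_contactField,
    Pi.add_apply, neg_add]

theorem contactField_zero : contactField (0 : Jet n → ℝ) = 0 := by
  ext1 z
  simp [contactField, dp, dx, du]
  rfl

theorem eq_exp_integral_mul {a f : ℝ → ℝ} (ha : ContinuousOn a (Icc 0 1))
    (hf : ∀ s ∈ Icc (0 : ℝ) 1, HasDerivWithinAt f (a s * f s) (Icc 0 1) s) :
    f 1 = Real.exp (∫ s in 0..1, a s) * f 0 := by
  let A : ℝ → ℝ := fun s => ∫ u in 0..s, a u
  have hA (s : ℝ) (hs : s ∈ Icc (0 : ℝ) 1) : HasDerivWithinAt A (a s) (Icc 0 1) s := by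
    have : Fact (s ∈ Icc (0 : ℝ) 1) := ⟨hs⟩
    exact intervalIntegral.integral_hasDerivWithinAt_right
      (ha.mono (uIcc_of_le hs.1 ▸ Icc_subset_Icc_right hs.2)).intervalIntegrable
      (ha.stronglyMeasurableAtFilter_nhdsWithin measurableSet_Icc s) (ha s hs)
  have hconst (s : ℝ) (hs : s ∈ Icc (0 : ℝ) 1) :
      HasDerivWithinAt (fun s => Real.exp (-A s) * f s) 0 (Icc 0 1) s :=
    ((hA s hs).fun_neg.exp.fun_mul (hf s hs)).congr_deriv (by ring)
  have h := constant_of_derivWithin_zero (fun s hs => (hconst s hs).differentiableWithinAt)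
    (fun s hs => (hconst s (Ico_subset_Icc_self hs)).derivWithin
      (uniqueDiffOn_Icc zero_lt_one s (Ico_subset_Icc_self hs))) 1 (right_mem_Icc.2 zero_le_one)
  have hA0 : A 0 = 0 := intervalIntegral.integral_same
  rw [hA0, neg_zero, Real.exp_zero, one_mul] at h
  rw [← h, ← mul_assoc, ← Real.exp_add, add_neg_cancel, Real.exp_zero, one_mul]

theorem IsInfinitesimalContact.exists_contactForm_fderiv_timeOneMap
    (hX : IsInfinitesimalContact X μ) (hX' : ContDiff ℝ ∞ X) (hμ : Continuous μ) {z : Jet n}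
    (hz : UnitFlowDefined X z) :
    ∃ l : ℝ, ∀ v, contactForm (timeOneMap X z) (fderiv ℝ (timeOneMap X) z v) =
      Real.exp l * contactForm z v := by
  obtain ⟨γ, hγ⟩ := hz
  refine ⟨∫ s in 0..1, μ (γ s), fun v => ?_⟩
  obtain ⟨η, hη⟩ := hγ.exists_isVariation hX' v
  rw [hη.fderiv_timeOneMap_eq hX' hγ, hγ.timeOneMap_eq (hX'.of_le (by simp))]
  have h := eq_exp_integral_mul (f := fun s => contactForm (γ s) (η s))
    (hμ.comp_continuousOn hγ.continuousOn) fun s hs =>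
      (hasDerivWithinAt_contactForm (hγ.2 s hs) (hη.2 s hs)).congr_deriv (hX (γ s) (η s))
  simpa only [hγ.1, hη.1, Function.comp_apply] using h

end ContactGeometry

section ContactFlow

variable {n : ℕ} {H : Jet n → ℝ}

theorem contactFlowDefined_iff {t : ℝ} {z : Jet n} :
    ContactFlowDefined H t z ↔ UnitFlowDefined (t • contactField H) z := flowDefined_iff

theorem contactFlow_eq_timeOneMap (hH : ContDiff ℝ ∞ H) (t : ℝ) :
    contactFlow H t = timeOneMap (t • contactField H) :=
  funext fun z => flow_eq_timeOneMap ((contDiff_contactField hH).of_le (by simp)) t z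

theorem contactFlow_zero (hH : ContDiff ℝ ∞ H) (z : Jet n) : contactFlow H 0 z = z := by
  rw [contactFlow_eq_timeOneMap hH, timeOneMap_zero_smul]

theorem isOpen_setOf_contactFlowDefined (hH : ContDiff ℝ ∞ H) (t : ℝ) :
    IsOpen {z | ContactFlowDefined H t z} := by
  simp only [contactFlowDefined_iff]
  exact isOpen_setOf_unitFlowDefined (((contDiff_contactField hH).of_le (by simp)).const_smul t)

theorem contDiffOn_contactFlow (hH : ContDiff ℝ ∞ H) (t : ℝ) :
    ContDiffOn ℝ ∞ (contactFlow H t) {z | ContactFlowDefined H t z} := by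
  simp only [contactFlowDefined_iff, contactFlow_eq_timeOneMap hH]
  exact contDiffOn_timeOneMap ((contDiff_contactField hH).const_smul t)

theorem contactFlow_neg (hH : ContDiff ℝ ∞ H) {t : ℝ} {z : Jet n}
    (hz : ContactFlowDefined H t z) :
    ContactFlowDefined H (-t) (contactFlow H t z) ∧ contactFlow H (-t) (contactFlow H t z) = z := by
  simp only [contactFlowDefined_iff, contactFlow_eq_timeOneMap hH, neg_smul] at hz ⊢
  exact timeOneMap_neg (((contDiff_contactField hH).of_le (by simp)).const_smul t) hz

theorem exists_contactForm_fderiv_contactFlow (hH : ContDiff ℝ ∞ H) {t : ℝ} {z : Jet n}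
    (hz : ContactFlowDefined H t z) :
    ∃ l : ℝ, ∀ v, contactForm (contactFlow H t z) (fderiv ℝ (contactFlow H t) z v) =
      Real.exp l * contactForm z v := by
  rw [contactFlow_eq_timeOneMap hH]
  exact ((isInfinitesimalContact_contactField hH).smul t).exists_contactForm_fderiv_timeOneMap
    ((contDiff_contactField hH).const_smul t) ((contDiff_du hH).continuous.neg.const_smul t)
    (contactFlowDefined_iff.1 hz)

/-- The flow of `X_H` as a family of maps parametrized by time. -/
def flowFamily (H : Jet n → ℝ) (y : ℝ × Jet n) : Jet n := contactFlow H y.1 y.2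

theorem eventually_contactFlowDefined (hH : ContDiff ℝ ∞ H) :
    ∀ᶠ y in timeZero (Jet n), ContactFlowDefined H y.1 y.2 := by
  simp only [contactFlowDefined_iff]
  exact eventually_timeZero.2 fun z => (isOpen_flowDomain
    ((contDiff_contactField hH).of_le (by simp))).mem_nhds (unitFlowDefined_zero_smul _ z)

theorem nearId_flowFamily (hH : ContDiff ℝ ∞ H) : NearId (flowFamily H) := by
  refine ⟨fun z => ?_, contactFlow_zero hH⟩
  unfold flowFamily
  simp only [contactFlow_eq_timeOneMap hH]
  exact (contDiffOn_timeOneMap_smul (contDiff_contactField hH)).contDiffAt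
    ((isOpen_flowDomain ((contDiff_contactField hH).of_le (by simp))).mem_nhds
      (unitFlowDefined_zero_smul _ z))

theorem hasDerivAt_flowFamily (hH : ContDiff ℝ ∞ H) (z : Jet n) :
    HasDerivAt (fun t => flowFamily H (t, z)) (contactField H z) 0 := by
  simp only [flowFamily, contactFlow_eq_timeOneMap hH]
  exact hasDerivAt_timeOneMap_smul_zero ((contDiff_contactField hH).of_le (by simp)) z

theorem reparam_zero_flowFamily (hH : ContDiff ℝ ∞ H) (m : ℕ) :
    reparam 0 m (flowFamily H) = fun y => y.2 := by
  ext1 y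
  rw [reparam, zero_mul, (nearId_flowFamily hH).2]

theorem compose_reparam_flowFamily (hH : ContDiff ℝ ∞ H) (a b : ℝ) {m : ℕ} (hm : m ≠ 0) :
    compose (reparam a m (flowFamily H)) (reparam b m (flowFamily H)) =ᶠ[timeZero (Jet n)]
      reparam (a + b) m (flowFamily H) := eventually_timeZero.2 fun z => by
  obtain ⟨ε, hε, hev⟩ :=
    eventually_timeOneMap_add_smul ((contDiff_contactField hH).of_le (by simp)) z
  have hsmall : ∀ᶠ y : ℝ × Jet n in 𝓝 (0, z), |b * y.1 ^ m| + |a * y.1 ^ m| < ε := by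
    have hcont : Continuous fun y : ℝ × Jet n => |b * y.1 ^ m| + |a * y.1 ^ m| := by fun_prop
    exact hcont.continuousAt.eventually_lt_const (by simpa [hm] using hε)
  filter_upwards [hsmall, continuousAt_snd.eventually hev] with y hy hadd
  simp only [compose, reparam, flowFamily, contactFlow_eq_timeOneMap hH]
  rw [hadd _ _ hy, ← add_mul, add_comm b]

theorem compose_reparam_neg_flowFamily (hH : ContDiff ℝ ∞ H) (a : ℝ) {m : ℕ} (hm : m ≠ 0) :
    compose (reparam (-a) m (flowFamily H)) (reparam a m (flowFamily H)) =ᶠ[timeZero (Jet n)]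
      fun y => y.2 := by
  simpa only [neg_add_cancel, reparam_zero_flowFamily hH] using
    compose_reparam_flowFamily hH (-a) a hm

theorem congrMod_reparam_two_flowFamily (hH : ContDiff ℝ ∞ H) :
    CongrMod 3 (reparam 1 2 (flowFamily H)) (fun y => y.2 + y.1 ^ 2 • contactField H y.2) := by
  have hfirst := (nearId_flowFamily hH).congrMod_two (hasDerivAt_flowFamily hH)
  calc CongrMod 3 (reparam 1 2 (flowFamily H)) (reparam 1 2 fun y => y.2 + y.1 • contactField H y.2)
        := (hfirst.reparam 1 two_ne_zero).of_le (by lia)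
    _ = _ := by ext1 y; simp only [reparam, one_mul]

end ContactFlow

section Words

variable {n : ℕ} {w w' : List (Factor n)} {h : ℝ} {z : Jet n} {P : (Jet n → ℝ) → Prop}

/-- All Hamiltonians of the splitting method `w` satisfy `P`. -/
def WordOver (P : (Jet n → ℝ) → Prop) (w : List (Factor n)) : Prop := ∀ F ∈ w, P F.ham

theorem wordOver_cons {F : Factor n} : WordOver P (F :: w) ↔ P F.ham ∧ WordOver P w :=
  List.forall_mem_cons

theorem WordOver.append (hw : WordOver P w) (hw' : WordOver P w') : WordOver P (w ++ w') :=
  List.forall_mem_append.2 ⟨hw, hw'⟩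

theorem WordOver.map (hw : WordOver P w) {φ : Factor n → Factor n} (hφ : ∀ F, (φ F).ham = F.ham) :
    WordOver P (w.map φ) :=
  List.forall_mem_map.2 fun F hF => (hφ F).symm ▸ hw F hF

theorem WordOver.mono {Q : (Jet n → ℝ) → Prop} (hw : WordOver P w) (hPQ : ∀ H, P H → Q H) :
    WordOver Q w := fun F hF => hPQ _ (hw F hF)

/-- The factor running the same flow backwards. -/
def Factor.inv (F : Factor n) : Factor n := ⟨F.ham, F.sqrtScaled, -F.cPos, -F.cNeg⟩

/-- The method whose composition of flows inverts that of `w`. -/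
def invWord (w : List (Factor n)) : List (Factor n) := (w.map Factor.inv).reverse

theorem WordOver.invWord (hw : WordOver P w) : WordOver P (invWord w) := fun F hF =>
  hw.map (φ := Factor.inv) (fun _ => rfl) F (List.mem_reverse.1 hF)

theorem invWord_cons (F : Factor n) (w : List (Factor n)) :
    invWord (F :: w) = invWord w ++ [F.inv] := by simp [invWord]

theorem invWord_invWord (w : List (Factor n)) : invWord (invWord w) = w := by
  have h : (Factor.inv ∘ Factor.inv : Factor n → Factor n) = id := by
    ext1 F
    simp [Factor.inv]
  simp [invWord, h]

theorem Factor.time_inv (F : Factor n) (h : ℝ) : F.inv.time h = -F.time h := by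
  rw [Factor.time, Factor.time, ← neg_mul]
  congr 1
  split_ifs <;> rfl

theorem splittingMap_append (w w' : List (Factor n)) (h : ℝ) (z : Jet n) :
    splittingMap (w ++ w') h z = splittingMap w' h (splittingMap w h z) := by
  induction w generalizing z with
  | nil => rfl
  | cons _ _ ih => exact ih _

theorem splittingDefined_append (w w' : List (Factor n)) (h : ℝ) (z : Jet n) :
    SplittingDefined (w ++ w') h z ↔
      SplittingDefined w h z ∧ SplittingDefined w' h (splittingMap w h z) := by
  induction w generalizing z with
  | nil => simp [SplittingDefined, splittingMap]
  | cons _ _ ih => simp [SplittingDefined, splittingMap, ih, and_assoc]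

theorem splittingMap_invWord (hw : WordOver (ContDiff ℝ ∞) w) (hz : SplittingDefined w h z) :
    SplittingDefined (invWord w) h (splittingMap w h z) ∧
      splittingMap (invWord w) h (splittingMap w h z) = z := by
  induction w generalizing z with
  | nil => exact ⟨trivial, rfl⟩
  | cons F w ih =>
    obtain ⟨hF, hw⟩ := wordOver_cons.1 hw
    obtain ⟨hw_defined, hw_inv⟩ := ih hw hz.2
    obtain ⟨hF_defined, hF_inv⟩ := contactFlow_neg hF hz.1
    rw [← F.time_inv] at hF_defined hF_inv
    rw [invWord_cons, splittingDefined_append, splittingMap_append]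
    simp only [splittingMap, hw_inv]
    exact ⟨⟨hw_defined, hF_defined, trivial⟩, hF_inv⟩

theorem contDiffOn_splittingMap (hw : WordOver (ContDiff ℝ ∞) w) (h : ℝ) :
    ContDiffOn ℝ ∞ (splittingMap w h) {z | SplittingDefined w h z} := by
  induction w with
  | nil => exact contDiff_id.contDiffOn
  | cons F w ih =>
    obtain ⟨hF, hw⟩ := wordOver_cons.1 hw
    exact (ih hw).comp ((contDiffOn_contactFlow hF (F.time h)).mono fun z hz => hz.1)
      fun z hz => hz.2

theorem isOpen_setOf_splittingDefined (hw : WordOver (ContDiff ℝ ∞) w) (h : ℝ) :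
    IsOpen {z | SplittingDefined w h z} := by
  induction w with
  | nil => exact isOpen_univ
  | cons F w ih =>
    obtain ⟨hF, hw⟩ := wordOver_cons.1 hw
    exact (contDiffOn_contactFlow hF (F.time h)).continuousOn.isOpen_inter_preimage
      (isOpen_setOf_contactFlowDefined hF _) (ih hw)

theorem exists_contactForm_fderiv_splittingMap (hw : WordOver (ContDiff ℝ ∞) w)
    (hz : SplittingDefined w h z) :
    ∃ l : ℝ, ∀ v, contactForm (splittingMap w h z) (fderiv ℝ (splittingMap w h) z v) =
      Real.exp l * contactForm z v := by
  induction w generalizing z with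
  | nil =>
    exact ⟨0, fun v => by simp [splittingMap]⟩
  | cons F w ih =>
    obtain ⟨hF, hw⟩ := wordOver_cons.1 hw
    obtain ⟨l, hl⟩ := ih hw hz.2
    obtain ⟨l', hl'⟩ := exists_contactForm_fderiv_contactFlow hF hz.1
    refine ⟨l + l', fun v => ?_⟩
    have hflow : DifferentiableAt ℝ (contactFlow F.ham (F.time h)) z :=
      ((contDiffOn_contactFlow hF _).contDiffAt
        ((isOpen_setOf_contactFlowDefined hF _).mem_nhds hz.1)).differentiableAt (by simp)
    have hrest : DifferentiableAt ℝ (splittingMap w h) (contactFlow F.ham (F.time h) z) :=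
      ((contDiffOn_splittingMap hw h).contDiffAt
        ((isOpen_setOf_splittingDefined hw h).mem_nhds hz.2)).differentiableAt (by simp)
    have hchain : fderiv ℝ (splittingMap (F :: w) h) z = _ := fderiv_comp z hrest hflow
    rw [hchain, Real.exp_add, mul_assoc, ← hl', ← hl]
    rfl

theorem image_splittingMap_eq (hw : WordOver (ContDiff ℝ ∞) w) {V : Set (Jet n)}
    (hVw : ∀ z ∈ V, SplittingDefined w h z) :
    splittingMap w h '' V =
      {y | SplittingDefined (invWord w) h y} ∩ splittingMap (invWord w) h ⁻¹' V := by
  ext y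
  constructor
  · rintro ⟨z, hz, rfl⟩
    obtain ⟨hdef, hinv⟩ := splittingMap_invWord hw (hVw z hz)
    exact ⟨hdef, by rwa [mem_preimage, hinv]⟩
  · rintro ⟨hy, hyV⟩
    have hinv := (splittingMap_invWord hw.invWord hy).2
    rw [invWord_invWord] at hinv
    exact ⟨_, hyV, hinv⟩

theorem isContactomorphismOn_splittingMap (hw : WordOver (ContDiff ℝ ∞) w) {V : Set (Jet n)}
    (hV : IsOpen V) (hVw : ∀ z ∈ V, SplittingDefined w h z) :
    IsContactomorphismOn (splittingMap w h) V := by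
  have hsmooth_inv := contDiffOn_splittingMap hw.invWord h
  have himage := image_splittingMap_eq hw hVw
  choose! l hl using fun z hz => exists_contactForm_fderiv_splittingMap hw (hVw z hz)
  refine ⟨hV, ?_, (contDiffOn_splittingMap hw h).mono hVw, ⟨splittingMap (invWord w) h, ?_,
    fun z hz => (splittingMap_invWord hw (hVw z hz)).2⟩, l, hl⟩
  · rw [himage]
    exact hsmooth_inv.continuousOn.isOpen_inter_preimage
      (isOpen_setOf_splittingDefined hw.invWord h) hV
  · rw [himage]
    exact hsmooth_inv.mono inter_subset_left

/-- The exponent of `√|h|` in the time of a factor. -/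
def Factor.timeDegree (F : Factor n) : ℕ := if F.sqrtScaled then 1 else 2

theorem Factor.timeDegree_ne_zero (F : Factor n) : F.timeDegree ≠ 0 := by
  unfold Factor.timeDegree
  split_ifs <;> simp

theorem Factor.time_eq (F : Factor n) (h : ℝ) :
    F.time h = (if 0 ≤ h then F.cPos else F.cNeg) * √|h| ^ F.timeDegree := by
  unfold Factor.time Factor.timeDegree
  congr 1
  split_ifs <;> simp

theorem tendsto_sqrt_abs_zero : Tendsto (fun h : ℝ => √|h|) (𝓝 0) (𝓝 0) := by
  have hcont : Continuous fun h : ℝ => √|h| := by fun_prop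
  simpa using hcont.tendsto 0

theorem Factor.tendsto_time (F : Factor n) : Tendsto F.time (𝓝 0) (𝓝 0) := by
  have hpow : Tendsto (fun h : ℝ => max |F.cPos| |F.cNeg| * √|h| ^ F.timeDegree) (𝓝 0) (𝓝 0) := by
    simpa [F.timeDegree_ne_zero] using (tendsto_sqrt_abs_zero.pow F.timeDegree).const_mul _
  refine squeeze_zero_norm (fun h => ?_) hpow
  rw [F.time_eq, norm_mul, Real.norm_eq_abs, norm_pow, Real.norm_of_nonneg (Real.sqrt_nonneg _)]
  gcongr
  split_ifs
  exacts [le_max_left _ _, le_max_right _ _]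

theorem eventually_splittingDefined (hw : WordOver (ContDiff ℝ ∞) w) :
    ∀ᶠ y in timeZero (Jet n), SplittingDefined w y.1 y.2 := by
  induction w with
  | nil => exact .of_forall fun _ => trivial
  | cons F w ih =>
    obtain ⟨hF, hw⟩ := wordOver_cons.1 hw
    have hflow (z : Jet n) :
        ContinuousAt (fun y : ℝ × Jet n => contactFlow F.ham (F.time y.1) y.2) (0, z) := by
      have htime : F.time 0 = 0 := by simp [Factor.time]
      have htime_cont : ContinuousAt F.time 0 := by
        simpa only [ContinuousAt, htime] using F.tendsto_time
      have hpair : ContinuousAt (Prod.map F.time id : ℝ × Jet n → ℝ × Jet n) (0, z) :=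
        htime_cont.prodMap continuousAt_id
      exact ContinuousAt.comp (g := flowFamily F.ham)
        (by simpa [htime] using ((nearId_flowFamily hF).1 z).continuousAt) hpair
    filter_upwards
      [(tendsto_prodMap_timeZero F.tendsto_time).eventually (eventually_contactFlowDefined hF),
        (tendsto_prodMk_timeZero hflow).eventually (ih hw)] with y hy hy' using ⟨hy, hy'⟩

theorem exists_common_domain (hw : WordOver (ContDiff ℝ ∞) w) {H : Jet n → ℝ}
    (hH : ContDiff ℝ ∞ H) {U : Set (Jet n)} (hU : IsCompact U) :
    ∃ V : Set (Jet n), IsOpen V ∧ U ⊆ V ∧ ∃ h₀ : ℝ, 0 < h₀ ∧ ∀ h : ℝ, |h| < h₀ →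
      ∀ z ∈ V, SplittingDefined w h z ∧ ContactFlowDefined H h z := by
  obtain ⟨p, hp, q, hq, hpq⟩ := eventually_prod_iff.1 (prod_nhdsSet_le_timeZero hU
    ((eventually_splittingDefined hw).and (eventually_contactFlowDefined hH)))
  obtain ⟨V, hV, hUV, hVq⟩ := eventually_nhdsSet_iff_exists.1 hq
  obtain ⟨h₀, hh₀, hball⟩ := Metric.eventually_nhds_iff.1 hp
  exact ⟨V, hV, hUV, h₀, hh₀, fun h hh z hz => hpq (hball (by simpa using hh)) (hVq z hz)⟩

end Words

section WordFamilies

variable {n : ℕ} {w : List (Factor n)}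

/-- The flow of a factor at step size `h = τ²`, continued to a smooth family in `τ ∈ ℝ`. -/
def Factor.family (F : Factor n) : ℝ × Jet n → Jet n :=
  reparam F.cPos F.timeDegree (flowFamily F.ham)

/-- The composition of the families of the factors; as in `splittingMap`, the head acts first. -/
def wordFamily : List (Factor n) → ℝ × Jet n → Jet n
  | [] => fun y => y.2
  | F :: w => compose (wordFamily w) F.family

theorem Factor.nearId_family {F : Factor n} (hF : ContDiff ℝ ∞ F.ham) : NearId F.family :=
  (nearId_flowFamily hF).reparam F.cPos F.timeDegree_ne_zero

theorem Factor.compose_family_inv {F : Factor n} (hF : ContDiff ℝ ∞ F.ham) :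
    compose F.inv.family F.family =ᶠ[timeZero (Jet n)] fun y => y.2 :=
  compose_reparam_neg_flowFamily hF F.cPos F.timeDegree_ne_zero

theorem nearId_wordFamily (hw : WordOver (ContDiff ℝ ∞) w) : NearId (wordFamily w) := by
  induction w with
  | nil => exact nearId_snd
  | cons F w ih =>
    obtain ⟨hF, hw⟩ := wordOver_cons.1 hw
    exact (ih hw).comp (F.nearId_family hF)

theorem wordFamily_append (w w' : List (Factor n)) :
    wordFamily (w ++ w') = compose (wordFamily w') (wordFamily w) := by
  induction w with
  | nil => rfl
  | cons F w ih =>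
    simp only [List.cons_append, wordFamily, ih]
    rfl

theorem compose_wordFamily_invWord (hw : WordOver (ContDiff ℝ ∞) w) :
    compose (wordFamily (invWord w)) (wordFamily w) =ᶠ[timeZero (Jet n)] fun y => y.2 := by
  induction w with
  | nil => exact .of_forall fun _ => rfl
  | cons F w ih =>
    obtain ⟨hF, hw⟩ := wordOver_cons.1 hw
    filter_upwards [(ih hw).comp_tendsto (F.nearId_family hF).1.tendsto, F.compose_family_inv hF]
      with y hy hy'
    rw [invWord_cons, wordFamily_append]
    simp only [compose, wordFamily, Function.comp_apply] at hy hy' ⊢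
    rw [hy, hy']

/-- The method `w` with `τ = √h` replaced by `a * τ` in `wordFamily`, which does not involve the
coefficients `cNeg`; these stay unchanged. -/
def scaleWord (a : ℝ) (w : List (Factor n)) : List (Factor n) :=
  w.map fun F => ⟨F.ham, F.sqrtScaled, F.cPos * a ^ F.timeDegree, F.cNeg⟩

theorem WordOver.scaleWord {P : (Jet n → ℝ) → Prop} (hw : WordOver P w) (a : ℝ) :
    WordOver P (scaleWord a w) := hw.map fun _ => rfl

theorem wordFamily_scaleWord (a : ℝ) (w : List (Factor n)) :
    wordFamily (scaleWord a w) = reparam a 1 (wordFamily w) := by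
  induction w with
  | nil => rfl
  | cons F w ih =>
    ext1 y
    simp only [scaleWord, List.map_cons, wordFamily] at ih ⊢
    simp only [ih, compose, reparam, Factor.family, pow_one, mul_pow, mul_assoc]
    rfl

end WordFamilies

section OrderRaising

variable {n : ℕ} {H : Jet n → ℝ} {p : ℕ}

theorem exists_order_coefficients (hp : 3 ≤ p) :
    ∃ a b : ℝ, 2 * a ^ 2 - b ^ 2 = 1 ∧ 2 * a ^ p = b ^ p := by
  obtain ⟨θ, hθ_pos, hθ⟩ : ∃ θ : ℝ, 0 ≤ θ ∧ θ ^ p = 2 :=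
    ⟨(2 : ℝ) ^ ((p : ℝ)⁻¹), by positivity, Real.rpow_inv_natCast_pow (by norm_num) (by lia)⟩
  have hθ_sq : θ ^ 2 < 2 := by
    by_contra! hge
    have hθ_one : 1 < θ := by nlinarith
    have hθ_cube : θ ^ 3 ≤ θ ^ p := pow_le_pow_right₀ hθ_one.le hp
    nlinarith
  have hpos : 0 < 2 - θ ^ 2 := by linarith
  have hsq : (√(2 - θ ^ 2))⁻¹ ^ 2 = (2 - θ ^ 2)⁻¹ := by rw [inv_pow, Real.sq_sqrt hpos.le]
  refine ⟨(√(2 - θ ^ 2))⁻¹, θ * (√(2 - θ ^ 2))⁻¹, ?_, ?_⟩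
  · rw [mul_pow, hsq, ← sub_mul, mul_inv_cancel₀ hpos.ne']
  · rw [mul_pow, hθ]

theorem congrMod_reparam_expansion {f : ℝ × Jet n → Jet n} {e : Jet n → Jet n}
    (hf : CongrMod (p + 1) f (fun y => reparam 1 2 (flowFamily H) y + y.1 ^ p • e y.2)) (a : ℝ) :
    CongrMod (p + 1) (reparam a 1 f)
      (fun y => reparam (a ^ 2) 2 (flowFamily H) y + y.1 ^ p • (a ^ p • e y.2)) := by
  calc CongrMod (p + 1) (reparam a 1 f) _ :=
        (hf.reparam a one_ne_zero).of_le (one_mul _).ge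
    _ = _ := by
      ext1 y
      simp only [reparam, pow_one, one_mul, mul_pow, smul_smul,
        mul_comm (a ^ p)]

/-- The leading error coefficients add up to `2 a ^ p - b ^ p = 0`, the times to
`2 a ^ 2 - b ^ 2 = 1`. -/
theorem congrMod_succ_of_order_coefficients (hH : ContDiff ℝ ∞ H) (hp : p ≠ 0) {a b : ℝ}
    (hab : 2 * a ^ 2 - b ^ 2 = 1) (habp : 2 * a ^ p = b ^ p) {f g : ℝ × Jet n → Jet n}
    (hf : CongrMod p f (reparam 1 2 (flowFamily H))) (hg : SmoothGerm g)
    (hgf : compose g (reparam b 1 f) =ᶠ[timeZero (Jet n)] fun y => y.2) :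
    CongrMod (p + 1) (compose g (compose (reparam a 1 f) (reparam a 1 f)))
      (reparam 1 2 (flowFamily H)) := by
  obtain ⟨e, he, hfe⟩ := hf.exists_coeff
  have hflow (c : ℝ) : NearId (reparam c 2 (flowFamily H)) :=
    (nearId_flowFamily hH).reparam c two_ne_zero
  have hinv : CongrMod (p + 1) g _ := CongrMod.inverse_expansion hp (hflow _) (hflow (-b ^ 2))
    (he.const_smul (b ^ p)) (congrMod_reparam_expansion hfe b)
    (by simpa using compose_reparam_neg_flowFamily hH (-b ^ 2) two_ne_zero) hg hgf
  have hdouble := CongrMod.comp_expansion hp (hflow _) (hflow _) (he.const_smul (a ^ p))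
    (he.const_smul (a ^ p)) (congrMod_reparam_expansion hfe a) (congrMod_reparam_expansion hfe a)
  refine (CongrMod.comp_expansion hp (hflow _) ((hflow _).comp (hflow _))
    (he.const_smul (b ^ p)).neg ((he.const_smul (a ^ p)).add (he.const_smul (a ^ p)))
    hinv hdouble).trans (congrMod_of_eventuallyEq ?_ _)
  filter_upwards [compose_reparam_flowFamily hH (a ^ 2) (a ^ 2) two_ne_zero,
    compose_reparam_flowFamily hH (-b ^ 2) (a ^ 2 + a ^ 2) two_ne_zero] with y hy hy'
  have htime : -b ^ 2 + (a ^ 2 + a ^ 2) = 1 := by linarith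
  have herror : -(b ^ p • e y.2) + (a ^ p • e y.2 + a ^ p • e y.2) = 0 := by
    rw [← habp]
    module
  rw [herror, smul_zero, add_zero, ← htime, ← hy']
  simp only [compose] at hy ⊢
  rw [hy]

end OrderRaising

section Splittings

variable {n : ℕ} {P : (Jet n → ℝ) → Prop} {H K : Jet n → ℝ} {p : ℕ}

/-- Some composition of flows of Hamiltonians satisfying `P` agrees with `Φ_H^{τ²}` modulo
`τ ^ p`. -/
def HasSplitting (P : (Jet n → ℝ) → Prop) (H : Jet n → ℝ) (p : ℕ) : Prop :=
  ∃ w : List (Factor n), WordOver P w ∧ CongrMod p (wordFamily w) (reparam 1 2 (flowFamily H))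

theorem hasSplitting_three_iff (hH : ContDiff ℝ ∞ H) :
    HasSplitting P H 3 ↔ ∃ w : List (Factor n), WordOver P w ∧
      CongrMod 3 (wordFamily w) (fun y => y.2 + y.1 ^ 2 • contactField H y.2) :=
  exists_congr fun _ => and_congr_right fun _ =>
    ⟨fun h => h.trans (congrMod_reparam_two_flowFamily hH),
      fun h => h.trans (congrMod_reparam_two_flowFamily hH).symm⟩

theorem hasSplitting_of_mem (hH : P H) (p : ℕ) : HasSplitting P H p := by
  refine ⟨[⟨H, false, 1, 0⟩], by simpa [WordOver] using hH, ?_⟩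
  exact CongrMod.refl p _

theorem hasSplitting_zero : HasSplitting P (0 : Jet n → ℝ) 3 := by
  refine (hasSplitting_three_iff (H := (0 : Jet n → ℝ)) contDiff_const).2
    ⟨[], by simp [WordOver], ?_⟩
  simpa [contactField_zero, wordFamily] using CongrMod.refl 3 fun y : ℝ × Jet n => y.2

theorem HasSplitting.add (hH : ContDiff ℝ ∞ H) (hK : ContDiff ℝ ∞ K)
    (h : HasSplitting P H 3) (h' : HasSplitting P K 3) : HasSplitting P (H + K) 3 := by
  obtain ⟨w, hw, hwH⟩ := (hasSplitting_three_iff hH).1 h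
  obtain ⟨w', hw', hwK⟩ := (hasSplitting_three_iff hK).1 h'
  refine (hasSplitting_three_iff (H := H + K) (hH.add hK)).2 ⟨w' ++ w, hw'.append hw, ?_⟩
  rw [wordFamily_append, contactField_add hH hK]
  exact CongrMod.comp_expansion two_ne_zero nearId_snd nearId_snd (contDiff_contactField hH)
    (contDiff_contactField hK) hwH hwK

theorem HasSplitting.sum {ι : Type*} (t : Finset ι) {K : ι → Jet n → ℝ}
    (hK : ∀ i, ContDiff ℝ ∞ (K i)) (h : ∀ i, HasSplitting P (K i) 3) :
    HasSplitting P (∑ i ∈ t, K i) 3 := by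
  classical
  induction t using Finset.induction_on with
  | empty => exact hasSplitting_zero
  | insert i t hi ih =>
    rw [Finset.sum_insert hi]
    exact (h i).add (hK i) (by simpa only [Finset.sum_fn] using ContDiff.sum fun i _ => hK i) ih

theorem hasSplitting_jacobi (hH : ContDiff ℝ ∞ H) (hK : ContDiff ℝ ∞ K) (hPH : P H) (hPK : P K) :
    HasSplitting P (jacobi H K) 3 := by
  let A : Factor n := ⟨K, true, 1, 0⟩
  let B : Factor n := ⟨H, true, 1, 0⟩
  have hderiv {L : Jet n → ℝ} (hL : ContDiff ℝ ∞ L) (z : Jet n) :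
      HasDerivAt (fun τ => Factor.family ⟨L, true, 1, 0⟩ (τ, z)) (contactField L z) 0 := by
    simpa [Factor.family, reparam, Factor.timeDegree] using hasDerivAt_flowFamily hL z
  refine (hasSplitting_three_iff (contDiff_jacobi hH hK)).2
    ⟨[B, A, B.inv, A.inv], by simp [WordOver, A, B, Factor.inv, hPH, hPK], ?_⟩
  rw [contactField_jacobi hH hK]
  have hexpansion := commutator_expansion (contDiff_contactField hK) (contDiff_contactField hH)
    (A.nearId_family hK) (B.nearId_family hH) (A.inv.nearId_family hK).1
    (B.inv.nearId_family hH).1 (hderiv hK) (hderiv hH) (A.compose_family_inv hK)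
    (B.compose_family_inv hH)
  exact hexpansion

theorem HasSplitting.succ (hP : ∀ K, P K → ContDiff ℝ ∞ K) (hH : ContDiff ℝ ∞ H) (hp : 3 ≤ p)
    (h : HasSplitting P H p) : HasSplitting P H (p + 1) := by
  obtain ⟨w, hw, hwH⟩ := h
  obtain ⟨a, b, hab, habp⟩ := exists_order_coefficients hp
  have hb_smooth : WordOver (ContDiff ℝ ∞) (scaleWord b w) := (hw.scaleWord b).mono hP
  refine ⟨(scaleWord a w ++ scaleWord a w) ++ invWord (scaleWord b w),
    ((hw.scaleWord a).append (hw.scaleWord a)).append (hw.scaleWord b).invWord, ?_⟩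
  rw [wordFamily_append, wordFamily_append, wordFamily_scaleWord]
  refine congrMod_succ_of_order_coefficients hH (by lia) hab habp hwH
    (nearId_wordFamily hb_smooth.invWord).1 ?_
  rw [← wordFamily_scaleWord]
  exact compose_wordFamily_invWord hb_smooth

theorem HasSplitting.of_three (hP : ∀ K, P K → ContDiff ℝ ∞ K) (hH : ContDiff ℝ ∞ H)
    (h : HasSplitting P H 3) (q : ℕ) : HasSplitting P H (q + 3) := by
  induction q with
  | zero => exact h
  | succ q ih =>
    rw [Nat.add_right_comm]
    exact ih.succ hP hH (by lia)

end Splittings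

section DerivativeBounds

variable {E F : Type*} [NormedAddCommGroup E] [NormedSpace ℝ E] [NormedAddCommGroup F]
  [NormedSpace ℝ F]

theorem contDiffAt_iteratedFDeriv_slice {R : ℝ × E → F} {z : E} (hR : ContDiffAt ℝ ∞ R (0, z))
    (j : ℕ) :
    ContDiffAt ℝ ∞ (fun y : ℝ × E => iteratedFDeriv ℝ j (fun x => R (y.1, x)) y.2) (0, z) := by
  induction j with
  | zero =>
    simp only [iteratedFDeriv_zero_eq_comp]
    exact (continuousMultilinearCurryFin0 ℝ E F).symm.contDiff.contDiffAt.comp _ hR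
  | succ j ih =>
    simp only [iteratedFDeriv_succ_eq_comp_left]
    have hderiv : ContDiffAt ℝ ∞ (fun y : ℝ × E =>
        fderiv ℝ (iteratedFDeriv ℝ j fun x => R (y.1, x)) y.2) (0, z) :=
      ContDiffAt.fderiv
        (f := fun (y : ℝ × E) x => iteratedFDeriv ℝ j (fun x => R (y.1, x)) x)
        (ContDiffAt.comp (f := fun q : (ℝ × E) × E => (q.1.1, q.2)) ((0, z), z) ih (by fun_prop))
        contDiffAt_snd (by simp)
    exact hderiv.continuousLinearMap_comp ((continuousMultilinearCurryLeftEquiv ℝ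
      (fun _ : Fin (j + 1) => E) F).symm : _ →L[ℝ] E [×(j + 1)]→L[ℝ] F)

theorem SmoothGerm.exists_norm_iteratedFDeriv_le {R : ℝ × E → F} (hR : SmoothGerm R) {U : Set E}
    (hU : IsCompact U) (j : ℕ) :
    ∃ C : ℝ, ∀ᶠ y in 𝓝 (0 : ℝ) ×ˢ 𝓝ˢ U, ‖iteratedFDeriv ℝ j (fun x => R (y.1, x)) y.2‖ ≤ C := by
  obtain ⟨V, hUV, hV, hbounded⟩ :=
    exists_isOpen_isBounded_image_of_isCompact_of_forall_continuousAt
      ((isCompact_singleton (x := (0 : ℝ))).prod hU) (by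
        rintro ⟨_, z⟩ ⟨rfl, -⟩
        exact (contDiffAt_iteratedFDeriv_slice (hR z) j).continuousAt)
  obtain ⟨C, hC⟩ := hbounded.exists_norm_le
  rw [← nhdsSet_singleton, ← isCompact_singleton.nhdsSet_prod_eq hU]
  exact ⟨C, mem_of_superset (hV.mem_nhdsSet.2 hUV) fun y hy => hC _ (mem_image_of_mem _ hy)⟩

theorem eventually_iteratedFDeriv_sub_eq {p : ℕ} {f g R : ℝ × E → F} (hR : SmoothGerm R)
    (h : f =ᶠ[timeZero E] fun y => g y + y.1 ^ p • R y) (j : ℕ) :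
    ∀ᶠ y in timeZero E, iteratedFDeriv ℝ j (fun x => f (y.1, x) - g (y.1, x)) y.2 =
      y.1 ^ p • iteratedFDeriv ℝ j (fun x => R (y.1, x)) y.2 := eventually_timeZero.2 fun z => by
  have hsmooth : ∀ᶠ y in 𝓝 (0, z), ContDiffAt ℝ j R y :=
    ((hR z).of_le (mod_cast le_top)).eventually (by simp)
  filter_upwards [(eventually_timeZero.1 h z).eventually_nhds, hsmooth] with ⟨τ, x⟩ hy hRy
  have hslice : ContDiffAt ℝ j (fun x => R (τ, x)) x :=
    ContDiffAt.comp (g := R) (f := fun x : E => (τ, x)) x hRy (by fun_prop)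
  have hsub : (fun x => f (τ, x) - g (τ, x)) =ᶠ[𝓝 x] fun x => τ ^ p • R (τ, x) := by
    have hpair : ContinuousAt (fun x : E => (τ, x)) x := by fun_prop
    exact (hpair.eventually hy).mono fun x hx => sub_eq_of_eq_add' hx
  rw [(hsub.iteratedFDeriv ℝ j).eq_of_nhds, iteratedFDeriv_const_smul_apply' hslice]

theorem CongrMod.exists_norm_iteratedFDeriv_sub_le {p : ℕ} {f g : ℝ × E → F}
    (h : CongrMod p f g) {U : Set E} (hU : IsCompact U) (j : ℕ) :
    ∃ C : ℝ, ∀ᶠ τ in 𝓝 (0 : ℝ), ∀ z ∈ U,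
      ‖iteratedFDeriv ℝ j (fun x => f (τ, x) - g (τ, x)) z‖ ≤ C * |τ| ^ p := by
  obtain ⟨R, hR, h⟩ := h
  obtain ⟨C, hC⟩ := hR.exists_norm_iteratedFDeriv_le hU j
  refine ⟨C, ?_⟩
  filter_upwards [(hC.and (prod_nhdsSet_le_timeZero hU
    (eventually_iteratedFDeriv_sub_eq hR h j))).curry] with τ hτ z hz
  obtain ⟨hbound, heq⟩ := hτ.self_of_nhdsSet z hz
  rw [heq, norm_smul, norm_pow, Real.norm_eq_abs, mul_comm]
  gcongr

end DerivativeBounds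

section CrNorm

variable {n r : ℕ} {U : Set (Jet n)}

theorem CrNormLE.mono {f : Jet n → Jet n} {B B' : ℝ} (h : CrNormLE r U f B) (hB : B ≤ B') :
    CrNormLE r U f B' := fun j hj z hz => (h j hj z hz).trans hB

theorem CongrMod.exists_crNormLE {p : ℕ} {f g : ℝ × Jet n → Jet n} (h : CongrMod p f g)
    (hU : IsCompact U) (r : ℕ) :
    ∃ C : ℝ, ∀ᶠ τ in 𝓝 (0 : ℝ), CrNormLE r U (fun z => f (τ, z) - g (τ, z)) (C * |τ| ^ p) := by
  choose C hC using fun j => h.exists_norm_iteratedFDeriv_sub_le hU j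
  obtain ⟨B, hB⟩ := ((finite_Iic r).image C).bddAbove
  refine ⟨B, ((eventually_all_finite (finite_Iic r)).2 fun j _ => hC j).mono fun τ hτ j hj z hz =>
    (hτ j hj z hz).trans ?_⟩
  gcongr
  exact hB (mem_image_of_mem C hj)

end CrNorm

section SignedWords

variable {n : ℕ} {w w' : List (Factor n)} {P : (Jet n → ℝ) → Prop} {H : Jet n → ℝ} {h : ℝ}

/-- The factor run with the coefficient `cPos` for `h ≥ 0` and not at all for `h < 0`. -/
def Factor.forward (F : Factor n) : Factor n := ⟨F.ham, F.sqrtScaled, F.cPos, 0⟩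

/-- The factor run with the coefficient `cPos` for `h < 0` and not at all for `h ≥ 0`. -/
def Factor.backward (F : Factor n) : Factor n := ⟨F.ham, F.sqrtScaled, 0, F.cPos⟩

/-- The method that runs `w` for nonnegative and `w'` for negative step sizes. -/
def signedWord (w w' : List (Factor n)) : List (Factor n) :=
  w.map Factor.forward ++ w'.map Factor.backward

theorem WordOver.signedWord (hw : WordOver P w) (hw' : WordOver P w') :
    WordOver P (signedWord w w') :=
  (hw.map (φ := Factor.forward) fun _ => rfl).append (hw'.map (φ := Factor.backward) fun _ => rfl)

theorem splittingMap_map_eq_wordFamily {φ : Factor n → Factor n}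
    (hham : ∀ F, (φ F).ham = F.ham)
    (htime : ∀ F, (φ F).time h = F.cPos * √|h| ^ F.timeDegree) (w : List (Factor n))
    (z : Jet n) : splittingMap (w.map φ) h z = wordFamily w (√|h|, z) := by
  induction w generalizing z with
  | nil => rfl
  | cons F w ih =>
    simp only [List.map_cons, splittingMap, ih, hham, htime]
    rfl

theorem splittingMap_of_time_eq_zero (hw : WordOver (ContDiff ℝ ∞) w)
    (htime : ∀ F ∈ w, F.time h = 0) (z : Jet n) : splittingMap w h z = z := by
  induction w generalizing z with
  | nil => rfl
  | cons F w ih =>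
    obtain ⟨hF, hw⟩ := wordOver_cons.1 hw
    obtain ⟨hFtime, htime⟩ := List.forall_mem_cons.1 htime
    rw [splittingMap, hFtime, contactFlow_zero hF, ih hw htime]

theorem splittingMap_signedWord_of_nonneg (hw' : WordOver (ContDiff ℝ ∞) w') (hh : 0 ≤ h)
    (z : Jet n) : splittingMap (signedWord w w') h z = wordFamily w (√|h|, z) := by
  rw [signedWord, splittingMap_append,
    splittingMap_of_time_eq_zero (hw'.map (φ := Factor.backward) fun _ => rfl)]
  · exact splittingMap_map_eq_wordFamily (φ := Factor.forward) (fun _ => rfl)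
      (fun F => by rw [F.forward.time_eq, if_pos hh]; rfl) w z
  · exact List.forall_mem_map.2 fun F _ => by
      rw [F.backward.time_eq, if_pos hh, Factor.backward, zero_mul]

theorem splittingMap_signedWord_of_neg (hw : WordOver (ContDiff ℝ ∞) w) (hh : h < 0)
    (z : Jet n) : splittingMap (signedWord w w') h z = wordFamily w' (√|h|, z) := by
  rw [signedWord, splittingMap_append,
    splittingMap_of_time_eq_zero (hw.map (φ := Factor.forward) fun _ => rfl)]
  · exact splittingMap_map_eq_wordFamily (φ := Factor.backward) (fun _ => rfl)
      (fun F => by rw [F.backward.time_eq, if_neg hh.not_ge]; rfl) w' z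
  · exact List.forall_mem_map.2 fun F _ => by
      rw [F.forward.time_eq, if_neg hh.not_ge, Factor.forward, zero_mul]

theorem contactFlow_eq_reparam_of_nonneg (H : Jet n → ℝ) (hh : 0 ≤ h) (z : Jet n) :
    contactFlow H h z = reparam 1 2 (flowFamily H) (√|h|, z) := by
  simp [reparam, flowFamily, abs_of_nonneg hh, Real.sq_sqrt hh]

theorem contactFlow_eq_reparam_of_neg (H : Jet n → ℝ) (hh : h < 0) (z : Jet n) :
    contactFlow H h z = reparam (-1) 2 (flowFamily H) (√|h|, z) := by
  simp [reparam, flowFamily, abs_of_neg hh, Real.sq_sqrt (neg_nonneg.2 hh.le)]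

theorem congrMod_wordFamily_invWord (hw : WordOver (ContDiff ℝ ∞) w) (hH : ContDiff ℝ ∞ H)
    {p : ℕ} (hp : p ≠ 0) (hwH : CongrMod p (wordFamily w) (reparam 1 2 (flowFamily H))) :
    CongrMod p (wordFamily (invWord w)) (reparam (-1) 2 (flowFamily H)) := by
  have hk := ((nearId_flowFamily hH).reparam (-1) two_ne_zero).1
  refine congrMod_of_leftInverse_of_rightInverse hp hk ?_ (nearId_wordFamily hw.invWord).1
    (compose_wordFamily_invWord hw)
  refine (hwH.comp_left hk).trans (congrMod_of_eventuallyEq ?_ p)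
  simpa only [neg_neg] using compose_reparam_neg_flowFamily hH (-1) two_ne_zero

theorem exists_crNormLE_signedWord_invWord (hw : WordOver (ContDiff ℝ ∞) w)
    (hH : ContDiff ℝ ∞ H) {p : ℕ} (hp : p ≠ 0)
    (hwH : CongrMod (2 * p) (wordFamily w) (reparam 1 2 (flowFamily H))) {U : Set (Jet n)}
    (hU : IsCompact U) (r : ℕ) :
    ∃ C : ℝ, ∀ᶠ h in 𝓝 (0 : ℝ), CrNormLE r U
      (fun z => splittingMap (signedWord w (invWord w)) h z - contactFlow H h z)
      (C * |h| ^ p) := by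
  obtain ⟨C, hC⟩ := hwH.exists_crNormLE hU r
  obtain ⟨C', hC'⟩ :=
    (congrMod_wordFamily_invWord hw hH (by lia) hwH).exists_crNormLE hU r
  have hpow (h : ℝ) : abs √|h| ^ (2 * p) = |h| ^ p := by
    rw [abs_of_nonneg (Real.sqrt_nonneg _), pow_mul, Real.sq_sqrt (abs_nonneg h)]
  refine ⟨max C C', ?_⟩
  filter_upwards [tendsto_sqrt_abs_zero.eventually hC, tendsto_sqrt_abs_zero.eventually hC']
    with h hpos hneg
  rw [hpow] at hpos hneg
  rcases le_or_gt 0 h with hh | hh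
  · simp only [splittingMap_signedWord_of_nonneg hw.invWord hh,
      contactFlow_eq_reparam_of_nonneg H hh]
    exact hpos.mono (by gcongr; exact le_max_left _ _)
  · simp only [splittingMap_signedWord_of_neg hw hh, contactFlow_eq_reparam_of_neg H hh]
    exact hneg.mono (by gcongr; exact le_max_right _ _)

theorem HasSplitting.exists_crNormLE (hP : ∀ K, P K → ContDiff ℝ ∞ K) (hH : ContDiff ℝ ∞ H)
    (h : HasSplitting P H 3) {U : Set (Jet n)} (hU : IsCompact U) (k : ℕ) :
    ∃ w : List (Factor n), WordOver P w ∧ ∀ r : ℕ, ∃ C : ℝ, ∀ᶠ h in 𝓝 (0 : ℝ),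
      CrNormLE r U (fun z => splittingMap w h z - contactFlow H h z) (C * |h| ^ (k + 1)) := by
  obtain ⟨w, hw, hwH⟩ := h.of_three hP hH (2 * k)
  exact ⟨signedWord w (invWord w), hw.signedWord hw.invWord,
    exists_crNormLE_signedWord_invWord (hw.mono hP) hH k.succ_ne_zero (hwH.of_le (by lia)) hU⟩

end SignedWords

section Hamiltonian

variable {n : ℕ} {ι : Type*} [Fintype ι] {P : (Jet n → ℝ) → Prop} {s₀ d₀ : Jet n → ℝ}
  {s d : ι → Jet n → ℝ}

theorem contDiff_sum_jacobi (hs : ∀ i, ContDiff ℝ ∞ (s i)) (hd : ∀ i, ContDiff ℝ ∞ (d i)) :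
    ContDiff ℝ ∞ (∑ i, jacobi (s i) (d i)) := by
  simpa only [Finset.sum_fn] using ContDiff.sum fun i _ => contDiff_jacobi (hs i) (hd i)

theorem hasSplitting_add_add_sum_jacobi (hP : ∀ K, P K → ContDiff ℝ ∞ K) (hs₀ : P s₀)
    (hd₀ : P d₀) (hs : ∀ i, P (s i)) (hd : ∀ i, P (d i)) :
    HasSplitting P (s₀ + d₀ + ∑ i, jacobi (s i) (d i)) 3 := by
  have hs_smooth (i : ι) := hP _ (hs i)
  have hd_smooth (i : ι) := hP _ (hd i)
  have hsplit₀ : HasSplitting P (s₀ + d₀) 3 :=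
    .add (hP _ hs₀) (hP _ hd₀) (hasSplitting_of_mem hs₀ 3) (hasSplitting_of_mem hd₀ 3)
  exact hsplit₀.add ((hP _ hs₀).add (hP _ hd₀)) (contDiff_sum_jacobi hs_smooth hd_smooth)
    (.sum _ (fun i => contDiff_jacobi (hs_smooth i) (hd_smooth i)) fun i =>
      hasSplitting_jacobi (hs_smooth i) (hd_smooth i) (hs i) (hd i))

end Hamiltonian

end

end ContactSplitting

theorem mainTheorem3_general {n : ℕ} {ι : Type*} [Fintype ι]
    (s₀ d₀ : ContactSplitting.Jet n → ℝ) (s d : ι → ContactSplitting.Jet n → ℝ)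
    (hs₀ : ContDiff ℝ ∞ s₀) (hd₀ : ContDiff ℝ ∞ d₀)
    (hs : ∀ i, ContDiff ℝ ∞ (s i)) (hd : ∀ i, ContDiff ℝ ∞ (d i))
    (H : ContactSplitting.Jet n → ℝ)
    (hH : ∀ z, H z = s₀ z + d₀ z + ∑ i, ContactSplitting.jacobi (s i) (d i) z)
    (U : Set (ContactSplitting.Jet n)) (hU : IsCompact U) (k : ℕ) :
    ∃ w : List (ContactSplitting.Factor n),
      (∀ F ∈ w, F.ham = s₀ ∨ F.ham = d₀ ∨ (∃ i, F.ham = s i) ∨ (∃ i, F.ham = d i)) ∧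
      (∃ V : Set (ContactSplitting.Jet n), IsOpen V ∧ U ⊆ V ∧
        ∃ h₀ : ℝ, 0 < h₀ ∧ ∀ h : ℝ, |h| < h₀ →
          (∀ z ∈ V, ContactSplitting.SplittingDefined w h z) ∧
          ContactSplitting.IsContactomorphismOn (ContactSplitting.splittingMap w h) V ∧
          (∀ z ∈ V, ContactSplitting.ContactFlowDefined H h z) ∧
          ContDiffOn ℝ ∞ (ContactSplitting.contactFlow H h) V) ∧
      ∀ r : ℕ, ∃ C : ℝ, ∀ᶠ h in nhds (0 : ℝ),
        ContactSplitting.CrNormLE r U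
          (fun z => ContactSplitting.splittingMap w h z - ContactSplitting.contactFlow H h z)
          (C * |h| ^ (k + 1)) := by
  let P : (ContactSplitting.Jet n → ℝ) → Prop := fun K =>
    K = s₀ ∨ K = d₀ ∨ (∃ i, K = s i) ∨ (∃ i, K = d i)
  have hP (K) : P K → ContDiff ℝ ∞ K := by
    rintro (rfl | rfl | ⟨i, rfl⟩ | ⟨i, rfl⟩)
    exacts [hs₀, hd₀, hs i, hd i]
  have hH_eq : H = s₀ + d₀ + ∑ i, ContactSplitting.jacobi (s i) (d i) :=
    funext fun z => by simp [hH]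
  have hH_smooth : ContDiff ℝ ∞ H :=
    hH_eq ▸ (hs₀.add hd₀).add (ContactSplitting.contDiff_sum_jacobi hs hd)
  have hH_splitting : ContactSplitting.HasSplitting P H 3 :=
    hH_eq ▸ ContactSplitting.hasSplitting_add_add_sum_jacobi hP (.inl rfl) (.inr (.inl rfl))
      (fun i => .inr (.inr (.inl ⟨i, rfl⟩))) fun i => .inr (.inr (.inr ⟨i, rfl⟩))
  obtain ⟨w, hw, herror⟩ := hH_splitting.exists_crNormLE hP hH_smooth hU k
  have hw_smooth := hw.mono hP
  obtain ⟨V, hV, hUV, h₀, hh₀, hdefined⟩ :=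
    ContactSplitting.exists_common_domain hw_smooth hH_smooth hU
  refine ⟨w, hw, ⟨V, hV, hUV, h₀, hh₀, fun h hh => ?_⟩, herror⟩
  have hVw := fun z hz => (hdefined h hh z hz).1
  have hVH := fun z hz => (hdefined h hh z hz).2
  exact ⟨hVw, ContactSplitting.isContactomorphismOn_splittingMap hw_smooth hV hVw, hVH,
    (ContactSplitting.contDiffOn_contactFlow hH_smooth h).mono hVH⟩

theorem mainTheorem3 {n : ℕ} {ι : Type*} [Fintype ι]
    (s₀ d₀ : ContactSplitting.Jet n → ℝ) (s d : ι → ContactSplitting.Jet n → ℝ)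
    (hs₀ : ContactSplitting.IsStrict s₀) (hd₀ : ContactSplitting.IsProlonged d₀)
    (hs : ∀ i, ContactSplitting.IsStrict (s i)) (hd : ∀ i, ContactSplitting.IsProlonged (d i))
    (H : ContactSplitting.Jet n → ℝ)
    (hH : ∀ z, H z = s₀ z + d₀ z + ∑ i, ContactSplitting.jacobi (s i) (d i) z)
    (U : Set (ContactSplitting.Jet n)) (hU : IsCompact U) (k : ℕ) :
    ∃ w : List (ContactSplitting.Factor n),
      (∀ F ∈ w, F.ham = s₀ ∨ F.ham = d₀ ∨ (∃ i, F.ham = s i) ∨ (∃ i, F.ham = d i)) ∧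
      (∃ V : Set (ContactSplitting.Jet n), IsOpen V ∧ U ⊆ V ∧
        ∃ h₀ : ℝ, 0 < h₀ ∧ ∀ h : ℝ, |h| < h₀ →
          (∀ z ∈ V, ContactSplitting.SplittingDefined w h z) ∧
          ContactSplitting.IsContactomorphismOn (ContactSplitting.splittingMap w h) V ∧
          (∀ z ∈ V, ContactSplitting.ContactFlowDefined H h z) ∧
          ContDiffOn ℝ ∞ (ContactSplitting.contactFlow H h) V) ∧
      ∀ r : ℕ, ∃ C : ℝ, ∀ᶠ h in nhds (0 : ℝ),
        ContactSplitting.CrNormLE r U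
          (fun z => ContactSplitting.splittingMap w h z - ContactSplitting.contactFlow H h z)
          (C * |h| ^ (k + 1)) :=
  mainTheorem3_general s₀ d₀ s d hs₀.1 hd₀.1 (fun i => (hs i).1) (fun i => (hd i).1) H hH U hU k
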